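/- Fix $d\in\mathbb N$ and $\ell\ge 0$. Let $\mathcal P_\ell(\mathbb R^d)$ be the set of Borel probability measures $m$ on $\mathbb R^d$ with $\int|x|^\ell\,m(dx)<\infty$ (all probability measures if $\ell=0$; $|x|^0=1$). A function $F:\mathcal P_\ell(\mathbb R^d)\to\mathbb R$ admits a linear functional derivative at $\mu\in\mathcal P_\ell(\mathbb R^d)$ if there is a measurable function $y\mapsto\frac{\delta F}{\delta m}(\mu,y)$ with $\sup_{y}\big|\frac{\delta F}{\delta m}(\mu,y)\big|/(1+|y|^\ell)<\infty$, $\frac{\delta F}{\delta m}(\mu,0)=0$ and $$\frac{d}{d\varepsilon}\Big|_{\varepsilon=0^+}F\big(\mu+\varepsilon(\nu-\mu)\big)=\int_{\mathbb R^d}\frac{\delta F}{\delta m}(\mu,y)\,(\nu-\mu)(dy)\qquad\text{for all }\nu\in\mathcal P_\ell(\mathbb R^d);$$ it is then unique. Higher order derivatives are defined inductively: $\frac{\delta^0U}{\delta m^0}=U$, and $\frac{\delta^{j}U}{\delta m^{j}}(\mu,\mathbf y,\cdot)$ is the linear functional derivative at $\mu$ of $m\mapsto\frac{\delta^{j-1}U}{\delta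 m^{j-1}}(m,\mathbf y)$, for each $\mathbf y\in(\mathbb R^d)^{j-1}$. (In particular $\frac{\delta^jU}{\delta m^j}$ vanishes when one of its space arguments is $0$.) For $j\in\mathbb N$ and $k\ge0$, $\mathcal S_{j,k}(\mathcal P_\ell(\mathbb R^d))$ is the set of $U:\mathcal P_\ell(\mathbb R^d)\to\mathbb R$ such that, for each $1\le i\le j$, $\frac{\delta^iU}{\delta m^i}$ exists on $\mathcal P_\ell(\mathbb R^d)\times(\mathbb R^d)^i$, is measurable in $(x_1,\dots,x_i)$ for each $\mu$, and satisfies, for some $C<\infty$ and all $\mu\in\mathcal P_\ell(\mathbb R^d)$ and $x_1,\dots,x_i\in\mathbb R^d$, $$\Big|\frac{\delta^iU}{\delta m^i}(\mu,x_1,\dots,x_i)\Big|\le C\Big(1+|x_1|^k+\dots+|x_i|^k+1_{\{\ell>0\}}\Big(\int_{\mathbb R^d}|x|^\ell\mu(dx)\Big)^{k/\ell}\Big).$$ **Statement.** Let $m_0\in\mathcal P_\ell(\mathbb R^d)$, let $\zeta_1,\zeta_2,\dots$ be i.i.d. random variables with law $m_0$, and let $m^N=\frac1N\sum_{i=1}^N\delta_{\zeta_i}$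 for $N\ge1$. Let $U\in\mathcal S_{1,\ell/2}(\mathcal P_\ell(\mathbb R^d))\cap\mathcal S_{2,\ell}(\mathcal P_\ell(\mathbb R^d))$, and suppose that for some $\alpha\in(0,1_{\{\ell=0\}}+\min(\ell,1)]$ and some $K<\infty$, $$\frac{\big|\frac{\delta^2U}{\delta m^2}(\mu,x,y)-\frac{\delta^2U}{\delta m^2}(\mu,x,z)\big|}{1+|x|^{\ell/2}}\le K|y-z|^\alpha\qquad\text{for all }\mu\in\mathcal P_\ell(\mathbb R^d),\ x,y,z\in\mathbb R^d.$$ Then $\frac{\delta U}{\delta m}(m_0,\zeta_1)$ is square integrable, and, as $N\to\infty$, $$\sqrt N\big(U(m^N)-U(m_0)\big)\stackrel{d}{\Longrightarrow}\mathcal N\Big(0,\operatorname{Var}\Big(\frac{\delta U}{\delta m}(m_0,\zeta_1)\Big)\Big).$$ Furthermore $U(m^N)-U(m_0)$ is integrable for every $N\ge1$, and $$\sup_{N\ge1}\sqrt N\,\mathbb E\big|U(m^N)-U(m_0)\big|<\infty.$$ -/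

import Mathlib

open MeasureTheory ProbabilityTheory Filter Topology
open scoped NNReal ENNReal

noncomputable section

/-- `ℝᵈ` with its Euclidean norm. -/
abbrev RdSpace (d : ℕ) : Type := EuclideanSpace ℝ (Fin d)

/-- `𝒫_ℓ(ℝᵈ)`: the Borel probability measures `m` on `ℝᵈ` with `∫ |x|^ℓ m(dx) < ∞`.
For `ℓ = 0` the integrand is `1`, so that these are all probability measures. -/
def PMoment (d : ℕ) (ℓ : ℝ) : Type :=
  {m : Measure (RdSpace d) // IsProbabilityMeasure m ∧ Integrable (fun x => ‖x‖ ^ ℓ) m}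

namespace PMoment

variable {d : ℕ} {ℓ : ℝ}

/-- The underlying measure. -/
def toMeasure (m : PMoment d ℓ) : Measure (RdSpace d) := m.1

instance isProbabilityMeasure_toMeasure (m : PMoment d ℓ) :
    IsProbabilityMeasure m.toMeasure := m.2.1

theorem integrable_rpow (m : PMoment d ℓ) : Integrable (fun x => ‖x‖ ^ ℓ) m.toMeasure := m.2.2

/-- The interpolation `μ + ε (ν - μ) = (1 - ε) μ + ε ν`, `0 ≤ ε ≤ 1`. -/
def mix (μ ν : PMoment d ℓ) (ε : unitInterval) : PMoment d ℓ :=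
  ⟨ENNReal.ofReal (1 - (ε : ℝ)) • μ.toMeasure + ENNReal.ofReal ε • ν.toMeasure, by
    refine ⟨⟨?_⟩, ?_⟩
    · simp only [Measure.add_apply, Measure.smul_apply, measure_univ, smul_eq_mul, mul_one]
      rw [← ENNReal.ofReal_add (sub_nonneg.2 ε.2.2) ε.2.1]
      simp
    · exact (μ.integrable_rpow.smul_measure ENNReal.ofReal_ne_top).add_measure
        (ν.integrable_rpow.smul_measure ENNReal.ofReal_ne_top)⟩

/-- The Dirac mass at `y`. -/
def dirac (y : RdSpace d) : PMoment d ℓ :=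
  ⟨Measure.dirac y, inferInstance, by
    have h : Integrable (fun _ : RdSpace d => ‖y‖ ^ ℓ) (Measure.dirac y) := integrable_const _
    exact h.congr (ae_eq_dirac (fun x : RdSpace d => ‖x‖ ^ ℓ)).symm⟩

/-- The empirical measure `(1/n) ∑ᵢ δ_{xᵢ}` of a nonempty finite family of `n` points. -/
def empirical {ι : Type} [Fintype ι] [Nonempty ι] (x : ι → RdSpace d) : PMoment d ℓ :=
  ⟨(Fintype.card ι : ℝ≥0∞)⁻¹ • ∑ i, Measure.dirac (x i), by
    refine ⟨⟨?_⟩, ?_⟩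
    · simp only [Measure.smul_apply, Measure.coe_finsetSum, Finset.sum_apply, measure_univ,
        Finset.sum_const, Finset.card_univ, nsmul_eq_mul, mul_one, smul_eq_mul]
      exact ENNReal.inv_mul_cancel (by simp) (by simp)
    · refine Integrable.smul_measure ?_ (by simp)
      exact integrable_finsetSum_measure.2
        fun i _ => (dirac (ℓ := ℓ) (x i)).integrable_rpow⟩

end PMoment

/-- `D = δF/δm(μ, ·)` is the (normalised) linear functional derivative of `F : 𝒫_ℓ(ℝᵈ) → ℝ` at `μ`:
it is measurable, has growth of order `ℓ`, vanishes at `0`, and, for every `ν ∈ 𝒫_ℓ(ℝᵈ)`, the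
right-hand derivative of `ε ↦ F (μ + ε (ν - μ))` at `ε = 0` exists and equals `∫ D d(ν - μ)`. -/
structure IsLinearFunctionalDeriv {d : ℕ} {ℓ : ℝ} (F : PMoment d ℓ → ℝ) (μ : PMoment d ℓ)
    (D : RdSpace d → ℝ) : Prop where
  measurable : Measurable D
  growth : ∃ C : ℝ, ∀ y, |D y| ≤ C * (1 + ‖y‖ ^ ℓ)
  tendsto_slope : ∀ ν : PMoment d ℓ,
    Tendsto (fun ε : unitInterval => (F (μ.mix ν ε) - F μ) / (ε : ℝ)) (𝓝[>] 0)
      (𝓝 (∫ y, D y ∂ν.toMeasure - ∫ y, D y ∂μ.toMeasure))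
  normalised : D 0 = 0

/-- `F` admits a linear functional derivative at `μ`. -/
def AdmitsLinearFunctionalDeriv {d : ℕ} {ℓ : ℝ} (F : PMoment d ℓ → ℝ) (μ : PMoment d ℓ) : Prop :=
  ∃ D, IsLinearFunctionalDeriv F μ D

/-- The linear functional derivative is unique. -/
theorem IsLinearFunctionalDeriv.unique {d : ℕ} {ℓ : ℝ} {F : PMoment d ℓ → ℝ} {μ : PMoment d ℓ}
    {D D' : RdSpace d → ℝ} (h : IsLinearFunctionalDeriv F μ D)
    (h' : IsLinearFunctionalDeriv F μ D') : D = D' := by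
  have : (𝓝[>] (0 : unitInterval)).NeBot := by
    apply nhdsGT_neBot_of_exists_gt
    exact ⟨1, by simp⟩
  have key : ∀ y, D y - ∫ z, D z ∂μ.toMeasure = D' y - ∫ z, D' z ∂μ.toMeasure := by
    intro y
    have e := tendsto_nhds_unique (h.tendsto_slope (PMoment.dirac y))
      (h'.tendsto_slope (PMoment.dirac y))
    have a : ∀ G : RdSpace d → ℝ,
        ∫ z, G z ∂(PMoment.dirac y : PMoment d ℓ).toMeasure = G y := by
      intro G
      exact integral_dirac G y
    rwa [a, a] at e
  have h0 := key 0
  rw [h.normalised, h'.normalised] at h0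
  funext y
  have := key y
  linarith

open Classical in
/-- `δF/δm(μ, ·)`; the value is meaningful when `F` admits a linear functional derivative
at `μ`. -/
def linearFunctionalDeriv {d : ℕ} {ℓ : ℝ} (F : PMoment d ℓ → ℝ) (μ : PMoment d ℓ) :
    RdSpace d → ℝ :=
  if h : AdmitsLinearFunctionalDeriv F μ then h.choose else 0

theorem IsLinearFunctionalDeriv.eq {d : ℕ} {ℓ : ℝ} {F : PMoment d ℓ → ℝ} {μ : PMoment d ℓ}
    {D : RdSpace d → ℝ} (h : IsLinearFunctionalDeriv F μ D) : linearFunctionalDeriv F μ = D := by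
  have hF : AdmitsLinearFunctionalDeriv F μ := ⟨D, h⟩
  rw [linearFunctionalDeriv, dif_pos hF]
  exact hF.choose_spec.unique h

/-- `δʲU/δmʲ(μ, y₁, …, y_j)`, defined inductively: `δʲ⁺¹U/δmʲ⁺¹(μ, y₁, …, y_j, ·)` is the linear
functional derivative at `μ` of `m ↦ δʲU/δmʲ(m, y₁, …, y_j)`. -/
def iteratedLinearFunctionalDeriv {d : ℕ} {ℓ : ℝ} (U : PMoment d ℓ → ℝ) :
    (j : ℕ) → PMoment d ℓ → (Fin j → RdSpace d) → ℝ
  | 0, μ, _ => U μ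
  | j + 1, μ, y =>
    linearFunctionalDeriv (fun m => iteratedLinearFunctionalDeriv U j m (Fin.init y)) μ
      (y (Fin.last j))

theorem linearFunctionalDeriv_zero {d : ℕ} {ℓ : ℝ} (F : PMoment d ℓ → ℝ) (μ : PMoment d ℓ) :
    linearFunctionalDeriv F μ 0 = 0 := by
  by_cases h : AdmitsLinearFunctionalDeriv F μ
  · rw [linearFunctionalDeriv, dif_pos h]
    exact h.choose_spec.normalised
  · rw [linearFunctionalDeriv, dif_neg h]
    rfl

/-- The normalisation: `δʲU/δmʲ` vanishes as soon as one of its space arguments is `0`. -/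
theorem iteratedLinearFunctionalDeriv_eq_zero {d : ℕ} {ℓ : ℝ} (U : PMoment d ℓ → ℝ) (j : ℕ)
    (μ : PMoment d ℓ) (y : Fin j → RdSpace d) (i : Fin j) (hi : y i = 0) :
    iteratedLinearFunctionalDeriv U j μ y = 0 := by
  induction j generalizing μ with
  | zero => exact i.elim0
  | succ j ih =>
    rw [iteratedLinearFunctionalDeriv]
    induction i using Fin.lastCases with
    | last => rw [hi, linearFunctionalDeriv_zero]
    | cast i =>
      have hF : (fun m => iteratedLinearFunctionalDeriv U j m (Fin.init y)) = fun _ => 0 := by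
        funext m
        exact ih m (Fin.init y) i hi
      have h0 : IsLinearFunctionalDeriv (fun _ : PMoment d ℓ => (0 : ℝ)) μ 0 :=
        ⟨measurable_const, ⟨0, by simp⟩, fun ν => by simpa using tendsto_const_nhds, rfl⟩
      rw [hF, h0.eq]
      rfl

/-- The class `𝒮_{j,k}(𝒫_ℓ(ℝᵈ))`: for each `1 ≤ i ≤ j` (written `i = n + 1`) the `i`-th order linear
functional derivative exists on `𝒫_ℓ(ℝᵈ) × (ℝᵈ)ⁱ`, is measurable in its space arguments, and is
bounded by `C (1 + |x₁|ᵏ + ⋯ + |xᵢ|ᵏ + 1_{ℓ > 0} (∫ |x|^ℓ μ(dx))^{k/ℓ})`. -/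
def ClassS (d j : ℕ) (k ℓ : ℝ) : Set (PMoment d ℓ → ℝ) :=
  {U | ∀ n < j,
    (∀ (μ : PMoment d ℓ) (y : Fin n → RdSpace d),
      AdmitsLinearFunctionalDeriv (fun m => iteratedLinearFunctionalDeriv U n m y) μ) ∧
    (∀ μ : PMoment d ℓ, Measurable (iteratedLinearFunctionalDeriv U (n + 1) μ)) ∧
    ∃ C : ℝ, ∀ (μ : PMoment d ℓ) (x : Fin (n + 1) → RdSpace d),
      |iteratedLinearFunctionalDeriv U (n + 1) μ x| ≤
        C * (1 + ∑ i, ‖x i‖ ^ k +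
          if 0 < ℓ then (∫ z, ‖z‖ ^ ℓ ∂μ.toMeasure) ^ (k / ℓ) else 0)}

end

/-! ### Convex combinations of measures and their moments. -/

namespace PMoment

variable {d : ℕ} {ℓ : ℝ}

/-! Replace the copies of `m₀` in `m₀ = (1/N) ∑ m₀` by Dirac masses one at a time. This gives
measures `μ_i` (`partialEmpirical`), with `μ_0 = m₀` and `μ_N` the empirical measure, and `U`
telescopes along them. By the mean value theorem on segments (`exists_sub_eq`) and the growth of the
second derivative, the `i`-th increment is `(1/N) (D μ_i (x_i) - ∫ D μ_i dm₀)` up to an error of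
order `N⁻²` (`taylor_succ`); these errors sum to `O(1/N)` in `L¹`.

Replacing `D μ_i` by `D m₀` leaves the ordinary centred sum plus `1/N` times a sum of
`centredIncrement`s. Since `μ_i` depends only on `x_0, …, x_{i-1}`, these are martingale
differences, hence orthogonal in `L²` (`integral_sq_sum_range`). Their sum is therefore `o(√N)` as
soon as the individual `L²` norms tend to `0` uniformly in `i ≤ N`.

That smallness is a law of large numbers uniform over test functions. The Hölder condition makes `y
↦ H ρ x y`, divided by `C (1 + |x|^(ℓ/2))`, a test function with modulus `testCost`, so `D μ_i - D
m₀` is controlled by any bound `w` in the sense of `IsGapBound` (`sq_sub_le`). Discretising space by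
simple functions reduces all test functions at once to finitely many indicators, whose centred sums
are at most `√N` in `L¹` (`integral_gapBound_le`).

Thus `√N` times the linearisation error tends to `0` in `L¹`. Slutsky's lemma and the classical
central limit theorem give the limit law, and the triangle inequality gives the bound on the first
absolute moment. -/

theorem ext_toMeasure {μ ν : PMoment d ℓ} (h : μ.toMeasure = ν.toMeasure) : μ = ν :=
  Subtype.ext h

theorem toMeasure_mix (μ ν : PMoment d ℓ) (ε : unitInterval) :
    (μ.mix ν ε).toMeasure =
      ENNReal.ofReal (1 - (ε : ℝ)) • μ.toMeasure + ENNReal.ofReal ε • ν.toMeasure := rfl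

theorem toMeasure_dirac (y : RdSpace d) :
    (dirac y : PMoment d ℓ).toMeasure = Measure.dirac y := rfl

theorem toMeasure_empirical {ι : Type} [Fintype ι] [Nonempty ι] (x : ι → RdSpace d) :
    (empirical x : PMoment d ℓ).toMeasure =
      (Fintype.card ι : ℝ≥0∞)⁻¹ • ∑ i, Measure.dirac (x i) := rfl

theorem mix_zero (μ ν : PMoment d ℓ) : μ.mix ν 0 = μ :=
  ext_toMeasure (by simp [toMeasure_mix])

theorem mix_one (μ ν : PMoment d ℓ) : μ.mix ν 1 = ν :=
  ext_toMeasure (by simp [toMeasure_mix])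

theorem integral_mix (μ ν : PMoment d ℓ) (s : unitInterval) {f : RdSpace d → ℝ}
    (hμ : Integrable f μ.toMeasure) (hν : Integrable f ν.toMeasure) :
    ∫ y, f y ∂(μ.mix ν s).toMeasure
      = (1 - (s : ℝ)) * ∫ y, f y ∂μ.toMeasure + s * ∫ y, f y ∂ν.toMeasure := by
  rw [toMeasure_mix, integral_add_measure (hμ.smul_measure ENNReal.ofReal_ne_top)
    (hν.smul_measure ENNReal.ofReal_ne_top), integral_smul_measure, integral_smul_measure,
    ENNReal.toReal_ofReal (sub_nonneg.2 s.2.2), ENNReal.toReal_ofReal s.2.1]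
  simp

theorem mix_mix_right (μ ν : PMoment d ℓ) (s ε t : unitInterval)
    (h : (t : ℝ) = s + ε * (1 - s)) : (μ.mix ν s).mix ν ε = μ.mix ν t := by
  apply ext_toMeasure
  have h1 := sub_nonneg.2 s.2.2
  have h2 := sub_nonneg.2 ε.2.2
  simp only [toMeasure_mix, smul_add, smul_smul, add_assoc, ← add_smul]
  rw [← ENNReal.ofReal_mul h2, ← ENNReal.ofReal_mul h2,
    ← ENNReal.ofReal_add (mul_nonneg h2 s.2.1) ε.2.1, h]
  congr 3 <;> ring

theorem mix_mix_left (μ ν : PMoment d ℓ) (s ε t : unitInterval)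
    (h : (t : ℝ) = s - ε * s) : (μ.mix ν s).mix μ ε = μ.mix ν t := by
  apply ext_toMeasure
  have h1 := sub_nonneg.2 s.2.2
  have h2 := sub_nonneg.2 ε.2.2
  simp only [toMeasure_mix, smul_add, smul_smul]
  rw [add_right_comm, ← add_smul, ← ENNReal.ofReal_mul h2, ← ENNReal.ofReal_mul h2,
    ← ENNReal.ofReal_add (mul_nonneg h2 h1) ε.2.1, h]
  congr 3 <;> ring

/-- The `ℓ`-th moment of `μ`. -/
noncomputable def moment (μ : PMoment d ℓ) : ℝ := ∫ z, ‖z‖ ^ ℓ ∂μ.toMeasure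

theorem moment_nonneg (μ : PMoment d ℓ) : 0 ≤ μ.moment :=
  integral_nonneg fun _ => Real.rpow_nonneg (norm_nonneg _) _

/-- The sum replaces the sharper convex combination so that the bound is free of `s`, which comes
from the mean value theorem and is unknown. -/
theorem moment_mix_le (μ ν : PMoment d ℓ) (s : unitInterval) :
    (μ.mix ν s).moment ≤ μ.moment + ν.moment := by
  rw [moment, integral_mix _ _ _ μ.integrable_rpow ν.integrable_rpow]
  have h1 := mul_le_mul_of_nonneg_right (sub_le_self 1 s.2.1) μ.moment_nonneg
  have h2 := mul_le_mul_of_nonneg_right s.2.2 ν.moment_nonneg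
  rw [one_mul] at h1 h2
  exact add_le_add h1 h2

theorem integrable_of_growth (μ : PMoment d ℓ) {f : RdSpace d → ℝ} (hf : Measurable f)
    {C : ℝ} (h : ∀ y, |f y| ≤ C * (1 + ‖y‖ ^ ℓ)) : Integrable f μ.toMeasure :=
  (((integrable_const (1 : ℝ)).add μ.integrable_rpow).const_mul C).mono' hf.aestronglyMeasurable
    (Eventually.of_forall h)

end PMoment

/-! ### Calculus along segments of measures. -/

namespace IsLinearFunctionalDeriv

variable {d : ℕ} {ℓ : ℝ} {F : PMoment d ℓ → ℝ} {D : PMoment d ℓ → RdSpace d → ℝ}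

theorem integrable {μ : PMoment d ℓ} {D : RdSpace d → ℝ} (h : IsLinearFunctionalDeriv F μ D)
    (ν : PMoment d ℓ) : Integrable D ν.toMeasure :=
  ν.integrable_of_growth h.measurable h.growth.choose_spec

theorem tendsto_projIcc_nhdsGT {l : Filter ℝ} {g : ℝ → ℝ} (hg : Tendsto g l (𝓝 0))
    (hpos : ∀ᶠ t in l, 0 < g t) :
    Tendsto (fun t => Set.projIcc (0 : ℝ) 1 zero_le_one (g t)) l (𝓝[>] 0) := by
  rw [tendsto_nhdsWithin_iff]
  refine ⟨?_, ?_⟩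
  · have h : Tendsto (Set.projIcc (0 : ℝ) 1 zero_le_one) (𝓝 0) (𝓝 0) := by
      have := (continuous_projIcc (a := (0 : ℝ)) (b := 1) (h := zero_le_one)).tendsto 0
      rwa [Set.projIcc_left] at this
    exact h.comp hg
  · filter_upwards [hpos] with t ht
    rw [Set.mem_Ioi, ← Subtype.coe_lt_coe, Set.coe_projIcc]
    simp [ht]

/-- Advancing from parameter `s` to `t` means mixing the current point with `ν` in proportion `(t -
s) / (1 - s)`, so the one-sided derivative of the definition, rescaled by `1 - s`, applies.
`Set.projIcc` only makes the path total on `ℝ`. -/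
theorem hasDerivWithinAt_Ici (h : ∀ m, IsLinearFunctionalDeriv F m (D m)) (μ ν : PMoment d ℓ)
    (s : unitInterval) (hs : (s : ℝ) < 1) :
    HasDerivWithinAt (fun t => F (μ.mix ν (Set.projIcc 0 1 zero_le_one t)))
      (∫ y, D (μ.mix ν s) y ∂ν.toMeasure - ∫ y, D (μ.mix ν s) y ∂μ.toMeasure) (Set.Ici s) s := by
  rw [← hasDerivWithinAt_Ioi_iff_Ici, hasDerivWithinAt_iff_tendsto_slope' (by simp)]
  have hs' : 0 < 1 - (s : ℝ) := sub_pos.2 hs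
  have hlim : Tendsto (fun t : ℝ => (t - s) / (1 - s)) (𝓝[>] (s : ℝ)) (𝓝 0) := by
    have : Continuous fun t : ℝ => (t - s) / (1 - s) := by fun_prop
    simpa using (this.tendsto (s : ℝ)).mono_left nhdsWithin_le_nhds
  have hpos : ∀ᶠ t : ℝ in 𝓝[>] (s : ℝ), 0 < (t - s) / (1 - s) := by
    filter_upwards [self_mem_nhdsWithin] with t ht
    exact div_pos (sub_pos.2 ht) hs'
  have key := (((h (μ.mix ν s)).tendsto_slope ν).comp
    (tendsto_projIcc_nhdsGT hlim hpos)).div_const (1 - (s : ℝ))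
  have hval : (∫ y, D (μ.mix ν s) y ∂ν.toMeasure - ∫ y, D (μ.mix ν s) y ∂(μ.mix ν s).toMeasure)
      / (1 - (s : ℝ)) = ∫ y, D (μ.mix ν s) y ∂ν.toMeasure - ∫ y, D (μ.mix ν s) y ∂μ.toMeasure := by
    rw [PMoment.integral_mix _ _ _ ((h _).integrable _) ((h _).integrable _)]
    field_simp
    ring
  rw [hval] at key
  refine key.congr' ?_
  filter_upwards [self_mem_nhdsWithin, Ioo_mem_nhdsGT hs] with t ht ht1
  have hst : (s : ℝ) < t := ht
  have h1 : (t - s) / (1 - (s : ℝ)) ∈ Set.Icc (0 : ℝ) 1 :=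
    ⟨div_nonneg (sub_nonneg.2 hst.le) hs'.le, (div_le_one hs').2 (by linarith [ht1.2])⟩
  have h2 : t ∈ Set.Icc (0 : ℝ) 1 := ⟨s.2.1.trans hst.le, ht1.2.le⟩
  simp only [Function.comp_apply, Set.projIcc_of_mem _ h1, slope_def_field,
    Set.projIcc_of_mem _ h2, Set.projIcc_val]
  rw [PMoment.mix_mix_right μ ν s _ ⟨t, h2⟩ (by simp only; field_simp; ring)]
  have : t - (s : ℝ) ≠ 0 := (sub_pos.2 hst).ne'
  field_simp

/-- Going backwards is mixing with `μ` in proportion `(s - t) / s`, so the right-hand derivative in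
the direction of `μ` yields a left derivative along the path. It has the same value as the right
derivative, which makes the path differentiable inside the segment. -/
theorem hasDerivWithinAt_Iic (h : ∀ m, IsLinearFunctionalDeriv F m (D m)) (μ ν : PMoment d ℓ)
    (s : unitInterval) (hs : 0 < (s : ℝ)) :
    HasDerivWithinAt (fun t => F (μ.mix ν (Set.projIcc 0 1 zero_le_one t)))
      (∫ y, D (μ.mix ν s) y ∂ν.toMeasure - ∫ y, D (μ.mix ν s) y ∂μ.toMeasure) (Set.Iic s) s := by
  rw [← hasDerivWithinAt_Iio_iff_Iic, hasDerivWithinAt_iff_tendsto_slope' (by simp)]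
  have hlim : Tendsto (fun t : ℝ => (s - t) / s) (𝓝[<] (s : ℝ)) (𝓝 0) := by
    have : Continuous fun t : ℝ => (s - t) / s := by fun_prop
    simpa using (this.tendsto (s : ℝ)).mono_left nhdsWithin_le_nhds
  have hpos : ∀ᶠ t : ℝ in 𝓝[<] (s : ℝ), 0 < (s - t) / s := by
    filter_upwards [self_mem_nhdsWithin] with t ht
    exact div_pos (sub_pos.2 ht) hs
  have key := (((h (μ.mix ν s)).tendsto_slope μ).comp
    (tendsto_projIcc_nhdsGT hlim hpos)).div_const (-(s : ℝ))
  have hval : (∫ y, D (μ.mix ν s) y ∂μ.toMeasure - ∫ y, D (μ.mix ν s) y ∂(μ.mix ν s).toMeasure)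
      / (-(s : ℝ)) = ∫ y, D (μ.mix ν s) y ∂ν.toMeasure - ∫ y, D (μ.mix ν s) y ∂μ.toMeasure := by
    rw [PMoment.integral_mix _ _ _ ((h _).integrable _) ((h _).integrable _)]
    field_simp
    ring
  rw [hval] at key
  refine key.congr' ?_
  filter_upwards [self_mem_nhdsWithin, Ioo_mem_nhdsLT hs] with t ht ht1
  have hst : t < (s : ℝ) := ht
  have h1 : (s - t) / (s : ℝ) ∈ Set.Icc (0 : ℝ) 1 :=
    ⟨div_nonneg (sub_nonneg.2 hst.le) hs.le, (div_le_one hs).2 (by linarith [ht1.1])⟩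
  have h2 : t ∈ Set.Icc (0 : ℝ) 1 := ⟨ht1.1.le, hst.le.trans s.2.2⟩
  simp only [Function.comp_apply, Set.projIcc_of_mem _ h1, slope_def_field,
    Set.projIcc_of_mem _ h2, Set.projIcc_val]
  rw [PMoment.mix_mix_left μ ν s _ ⟨t, h2⟩ (by simp only; field_simp; ring)]
  have : (s : ℝ) - t ≠ 0 := (sub_pos.2 hst).ne'
  have : t - (s : ℝ) ≠ 0 := (sub_neg.2 hst).ne
  field_simp
  ring

/-- The mean value theorem along the segment from `μ` to `ν`. -/
theorem exists_sub_eq (h : ∀ m, IsLinearFunctionalDeriv F m (D m)) (μ ν : PMoment d ℓ) :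
    ∃ s : unitInterval, F ν - F μ
      = ∫ y, D (μ.mix ν s) y ∂ν.toMeasure - ∫ y, D (μ.mix ν s) y ∂μ.toMeasure := by
  set u : ℝ → ℝ := fun t => F (μ.mix ν (Set.projIcc 0 1 zero_le_one t)) with hu
  set u' : ℝ → ℝ := fun t => ∫ y, D (μ.mix ν (Set.projIcc 0 1 zero_le_one t)) y ∂ν.toMeasure
    - ∫ y, D (μ.mix ν (Set.projIcc 0 1 zero_le_one t)) y ∂μ.toMeasure with hu'
  have hd : ∀ t ∈ Set.Ioo (0 : ℝ) 1, HasDerivAt u (u' t) t := by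
    intro t ht
    have ht' : t ∈ Set.Icc (0 : ℝ) 1 := ⟨ht.1.le, ht.2.le⟩
    have := (hasDerivWithinAt_Iic h μ ν ⟨t, ht'⟩ ht.1).union
      (hasDerivWithinAt_Ici h μ ν ⟨t, ht'⟩ ht.2)
    rw [Set.Iic_union_Ici, hasDerivWithinAt_univ] at this
    simpa only [hu', Set.projIcc_of_mem _ ht'] using this
  have hc : ContinuousOn u (Set.Icc 0 1) := by
    intro t ht
    rcases eq_or_lt_of_le ht.1 with rfl | h0
    · exact (hasDerivWithinAt_Ici h μ ν 0 (by simp)).continuousWithinAt.mono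
        (fun y hy => hy.1)
    rcases eq_or_lt_of_le ht.2 with rfl | h1
    · exact (hasDerivWithinAt_Iic h μ ν 1 (by simp)).continuousWithinAt.mono
        (fun y hy => hy.2)
    · exact (hd t ⟨h0, h1⟩).continuousAt.continuousWithinAt
  -- The mean value form needs no regularity of `u'`; an integral formula would require
  -- integrability in `t`.
  obtain ⟨t, -, ht⟩ := exists_hasDerivAt_eq_slope u u' one_pos hc hd
  refine ⟨Set.projIcc 0 1 zero_le_one t, ?_⟩
  have h0 : u 0 = F μ := by simp [hu, PMoment.mix_zero]
  have h1 : u 1 = F ν := by simp [hu, PMoment.mix_one]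
  rw [h0, h1, sub_zero, div_one] at ht
  exact ht.symm

end IsLinearFunctionalDeriv

/-! ### Measures interpolating between `m₀` and the empirical measure. -/

namespace PMoment

variable {d : ℕ} {ℓ : ℝ}

/-- The average of `n + 1` measures. -/
noncomputable def average {n : ℕ} (κ : Fin (n + 1) → PMoment d ℓ) : PMoment d ℓ :=
  ⟨((n + 1 : ℕ) : ℝ≥0∞)⁻¹ • ∑ j, (κ j).toMeasure, by
    refine ⟨⟨?_⟩, ?_⟩
    · simp only [Measure.smul_apply, Measure.coe_finsetSum, Finset.sum_apply, measure_univ,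
        Finset.sum_const, Finset.card_univ, nsmul_eq_mul, mul_one, smul_eq_mul, Fintype.card_fin]
      exact ENNReal.inv_mul_cancel (by simp) (by simp)
    · refine Integrable.smul_measure ?_ (by simp)
      exact integrable_finsetSum_measure.2 fun j _ => (κ j).integrable_rpow⟩

theorem toMeasure_average {n : ℕ} (κ : Fin (n + 1) → PMoment d ℓ) :
    (average κ).toMeasure = ((n + 1 : ℕ) : ℝ≥0∞)⁻¹ • ∑ j, (κ j).toMeasure := rfl

theorem integral_average {n : ℕ} (κ : Fin (n + 1) → PMoment d ℓ) {f : RdSpace d → ℝ}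
    (hf : ∀ j, Integrable f (κ j).toMeasure) :
    ∫ y, f y ∂(average κ).toMeasure = ((n : ℝ) + 1)⁻¹ * ∑ j, ∫ y, f y ∂(κ j).toMeasure := by
  rw [toMeasure_average, integral_smul_measure, integral_finsetSum_measure fun j _ => hf j,
    ENNReal.toReal_inv, ENNReal.toReal_natCast]
  simp

/-- The measure `(1/(n+1)) (∑_{j < i} δ_{xⱼ} + (n + 1 - i) m₀)` which interpolates between `m₀` and
the empirical measure of `x₀, …, xₙ`. -/
noncomputable def partialEmpirical (m₀ : PMoment d ℓ) (n i : ℕ) (x : ℕ → RdSpace d) :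
    PMoment d ℓ :=
  average fun j : Fin (n + 1) => if (j : ℕ) < i then dirac (x j) else m₀

variable (m₀ : PMoment d ℓ) (n : ℕ)

theorem partialEmpirical_zero (x : ℕ → RdSpace d) : m₀.partialEmpirical n 0 x = m₀ := by
  apply ext_toMeasure
  simp only [partialEmpirical, toMeasure_average, not_lt_zero, if_false, Finset.sum_const,
    Finset.card_univ, Fintype.card_fin]
  rw [← Nat.cast_smul_eq_nsmul ℝ≥0∞, smul_smul, ENNReal.inv_mul_cancel (by simp) (by simp),
    one_smul]

theorem partialEmpirical_last (x : ℕ → RdSpace d) :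
    m₀.partialEmpirical n (n + 1) x = empirical fun i : Fin (n + 1) => x i := by
  apply ext_toMeasure
  simp only [partialEmpirical, toMeasure_average, toMeasure_empirical, Fintype.card_fin, Fin.is_lt,
    if_true, toMeasure_dirac]

/-- This predictability is what later makes the increments martingale differences. -/
theorem partialEmpirical_congr {i : ℕ} {x y : ℕ → RdSpace d} (h : ∀ j < i, x j = y j) :
    m₀.partialEmpirical n i x = m₀.partialEmpirical n i y := by
  unfold partialEmpirical
  congr 1
  funext j
  split_ifs with hj
  · rw [h j hj]
  · rfl

variable {m₀ n} {f : RdSpace d → ℝ}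

theorem integral_partialEmpirical (hf : ∀ m : PMoment d ℓ, Integrable f m.toMeasure) {i : ℕ}
    (hi : i ≤ n + 1) (x : ℕ → RdSpace d) :
    ∫ y, f y ∂(m₀.partialEmpirical n i x).toMeasure - ∫ y, f y ∂m₀.toMeasure
      = ((n : ℝ) + 1)⁻¹ * ∑ j ∈ Finset.range i, (f (x j) - ∫ y, f y ∂m₀.toMeasure) := by
  have hn : (n : ℝ) + 1 ≠ 0 := by positivity
  have hint : ∀ j : Fin (n + 1),
      ∫ y, f y ∂(if (j : ℕ) < i then dirac (x j) else m₀ : PMoment d ℓ).toMeasure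
        = (if (j : ℕ) < i then f (x j) - ∫ y, f y ∂m₀.toMeasure else 0)
          + ∫ y, f y ∂m₀.toMeasure := by
    intro j
    split_ifs
    · rw [toMeasure_dirac, integral_dirac]; ring
    · ring
  rw [partialEmpirical, integral_average _ fun j => hf _, Finset.sum_congr rfl fun j _ => hint j,
    Finset.sum_add_distrib,
    Fin.sum_univ_eq_sum_range (fun j => if j < i then f (x j) - ∫ y, f y ∂m₀.toMeasure else 0),
    ← Finset.sum_filter]
  have : (Finset.range (n + 1)).filter (· < i) = Finset.range i := by
    ext j; simp only [Finset.mem_filter, Finset.mem_range]; omega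
  rw [this]
  simp only [Finset.sum_const, Finset.card_univ, Fintype.card_fin, nsmul_eq_mul]
  push_cast
  field_simp
  ring

theorem integral_partialEmpirical_succ (hf : ∀ m : PMoment d ℓ, Integrable f m.toMeasure) {i : ℕ}
    (hi : i ≤ n) (x : ℕ → RdSpace d) :
    ∫ y, f y ∂(m₀.partialEmpirical n (i + 1) x).toMeasure
        - ∫ y, f y ∂(m₀.partialEmpirical n i x).toMeasure
      = ((n : ℝ) + 1)⁻¹ * (f (x i) - ∫ y, f y ∂m₀.toMeasure) := by
  have h1 := integral_partialEmpirical (m₀ := m₀) hf (Nat.succ_le_succ hi) x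
  have h2 := integral_partialEmpirical (m₀ := m₀) hf (Nat.le_succ_of_le hi) x
  rw [Finset.sum_range_succ, mul_add] at h1
  linarith

theorem integral_partialEmpirical_sub (hf : ∀ m : PMoment d ℓ, Integrable f m.toMeasure) {i : ℕ}
    (hi : i ≤ n + 1) (x y : ℕ → RdSpace d) :
    ∫ z, f z ∂(m₀.partialEmpirical n i y).toMeasure - ∫ z, f z ∂(m₀.partialEmpirical n i x).toMeasure
      = ((n : ℝ) + 1)⁻¹ * ∑ j ∈ Finset.range i, (f (y j) - f (x j)) := by
  have h1 := integral_partialEmpirical (m₀ := m₀) hf hi x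
  have h2 := integral_partialEmpirical (m₀ := m₀) hf hi y
  rw [Finset.sum_sub_distrib, mul_sub] at h1 h2 ⊢
  linarith

/-- A bound for the moments of all `partialEmpirical m₀ n i x`. -/
noncomputable def envelope (m₀ : PMoment d ℓ) (n : ℕ) (x : ℕ → RdSpace d) : ℝ :=
  m₀.moment + ((n : ℝ) + 1)⁻¹ * ∑ j ∈ Finset.range (n + 1), ‖x j‖ ^ ℓ

theorem moment_partialEmpirical_le {i : ℕ} (hi : i ≤ n + 1) (x : ℕ → RdSpace d) :
    (m₀.partialEmpirical n i x).moment ≤ m₀.envelope n x := by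
  have h := integral_partialEmpirical (m₀ := m₀) (f := fun y => ‖y‖ ^ ℓ)
    (fun m => m.integrable_rpow) hi x
  have h1 : ∑ j ∈ Finset.range i, (‖x j‖ ^ ℓ - ∫ y, ‖y‖ ^ ℓ ∂m₀.toMeasure)
      ≤ ∑ j ∈ Finset.range (n + 1), ‖x j‖ ^ ℓ := by
    refine (Finset.sum_le_sum fun j _ => sub_le_self _ m₀.moment_nonneg).trans ?_
    exact Finset.sum_le_sum_of_subset_of_nonneg (Finset.range_mono hi)
      fun j _ _ => Real.rpow_nonneg (norm_nonneg _) _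
  have h2 : ((n : ℝ) + 1)⁻¹ * ∑ j ∈ Finset.range i, (‖x j‖ ^ ℓ - ∫ y, ‖y‖ ^ ℓ ∂m₀.toMeasure)
      ≤ ((n : ℝ) + 1)⁻¹ * ∑ j ∈ Finset.range (n + 1), ‖x j‖ ^ ℓ :=
    mul_le_mul_of_nonneg_left h1 (by positivity)
  unfold moment envelope moment
  linarith

end PMoment

/-! ### Quantitative derivative bounds and the class of test functions. -/

/-- `D` and `H` are the first two linear functional derivatives of `U`, with quantitative bounds. -/
structure HasSmoothDerivs {d : ℕ} {ℓ : ℝ} (U : PMoment d ℓ → ℝ) (D : PMoment d ℓ → RdSpace d → ℝ)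
    (H : PMoment d ℓ → RdSpace d → RdSpace d → ℝ) (C α : ℝ) : Prop where
  hasDeriv : ∀ μ, IsLinearFunctionalDeriv U μ (D μ)
  hasDeriv₂ : ∀ μ x, IsLinearFunctionalDeriv (fun m => D m x) μ (H μ x)
  one_le : 1 ≤ C
  α_pos : 0 < α
  sq_le : ∀ μ x, D μ x ^ 2 ≤ C * (1 + ‖x‖ ^ ℓ + μ.moment)
  abs_le : ∀ μ x y, |H μ x y| ≤ C * (1 + ‖x‖ ^ ℓ + ‖y‖ ^ ℓ + μ.moment)
  holder : ∀ μ x y z, |H μ x y - H μ x z|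
    ≤ C * (1 + ‖x‖ ^ (ℓ / 2)) * min (‖y - z‖ ^ α) (1 + ‖y‖ ^ ℓ + ‖z‖ ^ ℓ)

/-- The modulus of continuity of a class of test functions. -/
noncomputable def testCost {d : ℕ} (ℓ α : ℝ) (y z : RdSpace d) : ℝ :=
  min (‖y - z‖ ^ α) (1 + ‖y‖ ^ ℓ + ‖z‖ ^ ℓ) + |‖y‖ ^ ℓ - ‖z‖ ^ ℓ|

theorem testCost_nonneg {d : ℕ} {ℓ α : ℝ} (y z : RdSpace d) : 0 ≤ testCost ℓ α y z := by
  unfold testCost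
  positivity

theorem zero_rpow_le_one {ℓ : ℝ} : (0 : ℝ) ^ ℓ ≤ 1 := by
  by_cases h : ℓ = 0
  · simp [h]
  · simp [Real.zero_rpow h]

theorem testCost_zero_le {d : ℕ} {ℓ α : ℝ} (y : RdSpace d) :
    testCost ℓ α y 0 ≤ 3 * (1 + ‖y‖ ^ ℓ) := by
  unfold testCost
  have h0 : ‖(0 : RdSpace d)‖ ^ ℓ ≤ 1 := by rw [norm_zero]; exact zero_rpow_le_one
  have h1 : 0 ≤ ‖(0 : RdSpace d)‖ ^ ℓ := by positivity
  have h2 : 0 ≤ ‖y‖ ^ ℓ := by positivity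
  have h3 := min_le_right (‖y - 0‖ ^ α) (1 + ‖y‖ ^ ℓ + ‖(0 : RdSpace d)‖ ^ ℓ)
  have h4 : |‖y‖ ^ ℓ - ‖(0 : RdSpace d)‖ ^ ℓ| ≤ 1 + ‖y‖ ^ ℓ :=
    abs_le.2 ⟨by linarith, by linarith⟩
  linarith

/-- `w` bounds `|∫ g d(μ - m₀)|` for all test functions `g` with modulus `testCost`. -/
def IsGapBound {d : ℕ} {ℓ : ℝ} (α : ℝ) (m₀ μ : PMoment d ℓ) (w : ℝ) : Prop :=
  ∀ g : RdSpace d → ℝ, Measurable g → g 0 = 0 → (∀ y z, |g y - g z| ≤ testCost ℓ α y z) →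
    |∫ y, g y ∂μ.toMeasure - ∫ y, g y ∂m₀.toMeasure| ≤ w

theorem IsGapBound.nonneg {d : ℕ} {ℓ α w : ℝ} {m₀ μ : PMoment d ℓ} (h : IsGapBound α m₀ μ w) :
    0 ≤ w := by
  simpa using h 0 measurable_const rfl fun y z => by simpa using testCost_nonneg y z

theorem IsGapBound.moment_le {d : ℕ} {ℓ α w : ℝ} {m₀ μ : PMoment d ℓ}
    (h : IsGapBound α m₀ μ w) : μ.moment ≤ m₀.moment + w := by
  have h1 := h (fun y => ‖y‖ ^ ℓ - ‖(0 : RdSpace d)‖ ^ ℓ) (by fun_prop) (sub_self _) (by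
    intro y z
    have : 0 ≤ min (‖y - z‖ ^ α) (1 + ‖y‖ ^ ℓ + ‖z‖ ^ ℓ) := by positivity
    rw [sub_sub_sub_cancel_right]
    exact le_add_of_nonneg_left this)
  rw [integral_sub μ.integrable_rpow (integrable_const _),
    integral_sub m₀.integrable_rpow (integrable_const _)] at h1
  simp only [integral_const, probReal_univ, one_smul, sub_sub_sub_cancel_right] at h1
  have := (abs_le.1 h1).2
  unfold PMoment.moment
  linarith

/-- Simple functions on `ℝᵈ` which converge to the identity. -/
noncomputable def approxId (d k : ℕ) : SimpleFunc (RdSpace d) (RdSpace d) :=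
  SimpleFunc.approxOn id measurable_id Set.univ 0 (Set.mem_univ _) k

theorem tendsto_approxId {d : ℕ} (y : RdSpace d) : Tendsto (fun k => approxId d k y) atTop (𝓝 y) :=
  SimpleFunc.tendsto_approxOn measurable_id (Set.mem_univ _) (by simp)

theorem norm_approxId_le {d : ℕ} (k : ℕ) (y : RdSpace d) : ‖approxId d k y‖ ≤ 2 * ‖y‖ := by
  have := SimpleFunc.norm_approxOn_zero_le (f := (id : RdSpace d → RdSpace d)) measurable_id
    (s := Set.univ) (Set.mem_univ _) y k
  rw [id, ← two_mul] at this
  exact this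

/-! ### Taylor estimates, measurability, and control of the first derivative. -/

namespace HasSmoothDerivs

variable {d : ℕ} {ℓ : ℝ} {U : PMoment d ℓ → ℝ} {D : PMoment d ℓ → RdSpace d → ℝ}
  {H : PMoment d ℓ → RdSpace d → RdSpace d → ℝ} {C α : ℝ}

theorem integrable (h : HasSmoothDerivs U D H C α) (μ ν : PMoment d ℓ) :
    Integrable (D μ) ν.toMeasure :=
  (h.hasDeriv μ).integrable ν

theorem integrable₂ (h : HasSmoothDerivs U D H C α) (μ : PMoment d ℓ) (x : RdSpace d)
    (ν : PMoment d ℓ) : Integrable (H μ x) ν.toMeasure :=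
  (h.hasDeriv₂ μ x).integrable ν

theorem memLp_two (h : HasSmoothDerivs U D H C α) (μ ν : PMoment d ℓ) :
    MemLp (D μ) 2 ν.toMeasure := by
  rw [memLp_two_iff_integrable_sq (h.hasDeriv μ).measurable.aestronglyMeasurable]
  refine Integrable.mono' (((integrable_const (1 + μ.moment)).add ν.integrable_rpow).const_mul C)
    ((h.hasDeriv μ).measurable.pow_const 2).aestronglyMeasurable (Eventually.of_forall fun x => ?_)
  rw [Real.norm_eq_abs, abs_of_nonneg (sq_nonneg _)]
  refine (h.sq_le μ x).trans (le_of_eq ?_)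
  simp only [Pi.add_apply]
  ring

/-- Consecutive interpolants differ by `(δ_{x_i} - m₀) / (n + 1)`. The mean value theorem, applied
to `U` and then to `m ↦ D m y`, produces this small factor twice. -/
theorem taylor_succ (h : HasSmoothDerivs U D H C α) (m₀ : PMoment d ℓ) {n i : ℕ} (hi : i ≤ n)
    (x : ℕ → RdSpace d) :
    |U (m₀.partialEmpirical n (i + 1) x) - U (m₀.partialEmpirical n i x)
        - ((n : ℝ) + 1)⁻¹ * (D (m₀.partialEmpirical n i x) (x i)
            - ∫ y, D (m₀.partialEmpirical n i x) y ∂m₀.toMeasure)|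
      ≤ ((n : ℝ) + 1)⁻¹ ^ 2 * (21 * C * (1 + ‖x i‖ ^ ℓ + m₀.envelope n x)) := by
  set μ := m₀.partialEmpirical n i x with hμ
  set ν := m₀.partialEmpirical n (i + 1) x with hν
  set N : ℝ := ((n : ℝ) + 1)⁻¹ with hN
  have hN0 : 0 ≤ N := by positivity
  have hC := h.one_le
  set E := m₀.envelope n x with hE
  have hμE : μ.moment ≤ E := PMoment.moment_partialEmpirical_le (Nat.le_succ_of_le hi) x
  have hνE : ν.moment ≤ E := PMoment.moment_partialEmpirical_le (Nat.succ_le_succ hi) x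
  have hm₀E : m₀.moment ≤ E := by
    rw [hE, PMoment.envelope]
    exact le_add_of_nonneg_right (by positivity)
  have hxi : 0 ≤ ‖x i‖ ^ ℓ := by positivity
  obtain ⟨s, hs⟩ := IsLinearFunctionalDeriv.exists_sub_eq h.hasDeriv μ ν
  rw [PMoment.integral_partialEmpirical_succ (fun m => h.integrable _ m) hi] at hs
  rw [hs]
  have hdiff : ∀ y, |D (μ.mix ν s) y - D μ y|
      ≤ N * (7 * C * (1 + ‖y‖ ^ ℓ + ‖x i‖ ^ ℓ + E)) := by
    intro y
    obtain ⟨r, hr⟩ := IsLinearFunctionalDeriv.exists_sub_eq (fun m => h.hasDeriv₂ m y) μ (μ.mix ν s)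
    set ρ := μ.mix (μ.mix ν s) r with hρ
    -- The two nested mixtures cost `E` for `μ` and `2 * E` for `μ.mix ν s`. The moment of `ρ`
    -- enters two bounds on `H` and `m₀.moment` adds one more `E`, whence the constant 7; evaluating
    -- at `x i` and integrating over `m₀` then give `21 = 3 * 7`.
    have hρE : ρ.moment ≤ 3 * E := by
      have h1 := PMoment.moment_mix_le μ (μ.mix ν s) r
      have h2 := PMoment.moment_mix_le μ ν s
      linarith
    have hsucc := PMoment.integral_partialEmpirical_succ (m₀ := m₀)
      (fun m => h.integrable₂ ρ y m) hi x
    rw [PMoment.integral_mix _ _ _ (h.integrable₂ _ _ _) (h.integrable₂ _ _ _)] at hr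
    have hr' : D (μ.mix ν s) y - D μ y
        = s * (N * (H ρ y (x i) - ∫ z, H ρ y z ∂m₀.toMeasure)) := by
      rw [hr, ← hsucc]; ring
    have hy : 0 ≤ ‖y‖ ^ ℓ := by positivity
    have hint : |∫ z, H ρ y z ∂m₀.toMeasure| ≤ C * (1 + ‖y‖ ^ ℓ + m₀.moment + ρ.moment) := by
      have hle : ∀ z, ‖H ρ y z‖ ≤ C * ((1 + ‖y‖ ^ ℓ + ρ.moment) + ‖z‖ ^ ℓ) := fun z => by
        refine (h.abs_le ρ y z).trans (le_of_eq ?_); ring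
      refine (norm_integral_le_of_norm_le ?_ (Eventually.of_forall hle)).trans (le_of_eq ?_)
      · exact ((integrable_const _).add m₀.integrable_rpow).const_mul C
      · rw [integral_const_mul, integral_add (integrable_const _) m₀.integrable_rpow]
        simp only [integral_const, probReal_univ, one_smul, PMoment.moment]
        ring
    have hHx := h.abs_le ρ y (x i)
    rw [hr', abs_mul, abs_mul, abs_of_nonneg s.2.1, abs_of_nonneg hN0]
    have hT : |H ρ y (x i) - ∫ z, H ρ y z ∂m₀.toMeasure|
        ≤ 7 * C * (1 + ‖y‖ ^ ℓ + ‖x i‖ ^ ℓ + E) := by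
      refine (abs_sub _ _).trans ((add_le_add hHx hint).trans ?_)
      rw [← mul_add, mul_comm 7 C, mul_assoc]
      exact mul_le_mul_of_nonneg_left (by linarith) (by linarith)
    calc (s : ℝ) * (N * |H ρ y (x i) - ∫ z, H ρ y z ∂m₀.toMeasure|)
        ≤ 1 * (N * |H ρ y (x i) - ∫ z, H ρ y z ∂m₀.toMeasure|) :=
          mul_le_mul_of_nonneg_right s.2.2 (by positivity)
      _ ≤ _ := by rw [one_mul]; exact mul_le_mul_of_nonneg_left hT hN0
  have hint : |∫ y, (D (μ.mix ν s) y - D μ y) ∂m₀.toMeasure|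
      ≤ N * (7 * C * (1 + m₀.moment + ‖x i‖ ^ ℓ + E)) := by
    have hle : ∀ y, ‖D (μ.mix ν s) y - D μ y‖
        ≤ N * (7 * C * ((1 + ‖x i‖ ^ ℓ + E) + ‖y‖ ^ ℓ)) := fun y => by
      refine (hdiff y).trans (le_of_eq ?_); ring
    refine (norm_integral_le_of_norm_le ?_ (Eventually.of_forall hle)).trans (le_of_eq ?_)
    · exact (((integrable_const _).add m₀.integrable_rpow).const_mul _).const_mul N
    · rw [integral_const_mul, integral_const_mul,
        integral_add (integrable_const _) m₀.integrable_rpow]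
      simp only [integral_const, probReal_univ, one_smul, PMoment.moment]
      ring
  rw [← mul_sub, abs_mul, abs_of_nonneg hN0]
  rw [integral_sub (h.integrable _ _) (h.integrable _ _)] at hint
  have hT : |D (μ.mix ν s) (x i) - ∫ y, D (μ.mix ν s) y ∂m₀.toMeasure
      - (D μ (x i) - ∫ y, D μ y ∂m₀.toMeasure)| ≤ N * (21 * C * (1 + ‖x i‖ ^ ℓ + E)) := by
    rw [sub_sub_sub_comm]
    refine (abs_sub _ _).trans ((add_le_add (hdiff _) hint).trans ?_)
    rw [← mul_add]
    refine mul_le_mul_of_nonneg_left ?_ hN0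
    rw [← mul_add, show 21 * C * (1 + ‖x i‖ ^ ℓ + E) = 7 * C * (3 * (1 + ‖x i‖ ^ ℓ + E)) by ring]
    exact mul_le_mul_of_nonneg_left (by linarith) (by linarith)
  rw [pow_two, mul_assoc]
  exact mul_le_mul_of_nonneg_left hT hN0

/-- Hölder continuity of `H` in its last argument becomes continuity of `D` in the sample. This
serves only measurability, so the factor `1 / (n + 1)` is thrown away. -/
theorem abs_sub_mix_partialEmpirical_le (h : HasSmoothDerivs U D H C α) (m₀ : PMoment d ℓ)
    {n i : ℕ} (hi : i ≤ n + 1) (x y : ℕ → RdSpace d) (s : unitInterval) (z : RdSpace d) :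
    |D ((m₀.partialEmpirical n i x).mix (m₀.partialEmpirical n i y) s) z
        - D (m₀.partialEmpirical n i x) z|
      ≤ C * (1 + ‖z‖ ^ (ℓ / 2)) * ∑ j ∈ Finset.range i, ‖y j - x j‖ ^ α := by
  set μ := m₀.partialEmpirical n i x with hμ
  set ν := m₀.partialEmpirical n i y with hν
  have hC := h.one_le
  obtain ⟨r, hr⟩ := IsLinearFunctionalDeriv.exists_sub_eq (fun m => h.hasDeriv₂ m z) μ (μ.mix ν s)
  set ρ := μ.mix (μ.mix ν s) r with hρ
  have hsub := PMoment.integral_partialEmpirical_sub (m₀ := m₀)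
    (fun m => h.integrable₂ ρ z m) hi x y
  rw [PMoment.integral_mix _ _ _ (h.integrable₂ _ _ _) (h.integrable₂ _ _ _)] at hr
  have hr' : D (μ.mix ν s) z - D μ z
      = (s * ((n : ℝ) + 1)⁻¹) * ∑ j ∈ Finset.range i, (H ρ z (y j) - H ρ z (x j)) := by
    rw [hr, mul_assoc, ← hsub]; ring
  have hs0 : 0 ≤ (s : ℝ) * ((n : ℝ) + 1)⁻¹ := mul_nonneg s.2.1 (by positivity)
  have hs1 : (s : ℝ) * ((n : ℝ) + 1)⁻¹ ≤ 1 :=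
    mul_le_one₀ s.2.2 (by positivity) (inv_le_one_of_one_le₀ (by simp))
  rw [hr', abs_mul, abs_of_nonneg hs0, Finset.mul_sum]
  refine (mul_le_of_le_one_left (abs_nonneg _) hs1).trans ?_
  refine (Finset.abs_sum_le_sum_abs _ _).trans (Finset.sum_le_sum fun j _ => ?_)
  refine (h.holder ρ z (y j) (x j)).trans ?_
  exact mul_le_mul_of_nonneg_left (min_le_left _ _) (by positivity)

theorem taylor_partialEmpirical (h : HasSmoothDerivs U D H C α) (m₀ : PMoment d ℓ)
    {n i : ℕ} (hi : i ≤ n + 1) (x y : ℕ → RdSpace d) :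
    |U (m₀.partialEmpirical n i y) - (U (m₀.partialEmpirical n i x)
        + ((n : ℝ) + 1)⁻¹ * ∑ j ∈ Finset.range i, (D (m₀.partialEmpirical n i x) (y j)
          - D (m₀.partialEmpirical n i x) (x j)))|
      ≤ (∑ j ∈ Finset.range i, ‖y j - x j‖ ^ α) *
          (C * ∑ j ∈ Finset.range i, (2 + ‖y j‖ ^ (ℓ / 2) + ‖x j‖ ^ (ℓ / 2))) := by
  set μ := m₀.partialEmpirical n i x with hμ
  set ν := m₀.partialEmpirical n i y with hν
  have hC := h.one_le
  obtain ⟨s, hs⟩ := IsLinearFunctionalDeriv.exists_sub_eq h.hasDeriv μ ν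
  rw [PMoment.integral_partialEmpirical_sub (fun m => h.integrable _ m) hi] at hs
  have hN1 : ((n : ℝ) + 1)⁻¹ ≤ 1 := inv_le_one_of_one_le₀ (by simp)
  have hN0 : 0 ≤ ((n : ℝ) + 1)⁻¹ := by positivity
  rw [← sub_sub, hs, ← mul_sub, ← Finset.sum_sub_distrib, abs_mul, abs_of_nonneg hN0]
  refine (mul_le_of_le_one_left (abs_nonneg _) hN1).trans ?_
  rw [Finset.mul_sum, Finset.mul_sum]
  refine (Finset.abs_sum_le_sum_abs _ _).trans (Finset.sum_le_sum fun j _ => ?_)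
  have h1 := h.abs_sub_mix_partialEmpirical_le m₀ hi x y s (y j)
  have h2 := h.abs_sub_mix_partialEmpirical_le m₀ hi x y s (x j)
  rw [sub_sub_sub_comm]
  refine (abs_sub _ _).trans ((add_le_add h1 h2).trans (le_of_eq ?_))
  ring

/-- A Carathéodory function: continuous in the sample, measurable in the space argument. -/
theorem measurable_uncurry_deriv (h : HasSmoothDerivs U D H C α) (m₀ : PMoment d ℓ)
    {n i : ℕ} (hi : i ≤ n + 1) :
    Measurable fun p : (ℕ → RdSpace d) × RdSpace d => D (m₀.partialEmpirical n i p.1) p.2 := by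
  refine measurable_uncurry_of_continuous_of_measurable
    (u := fun x z => D (m₀.partialEmpirical n i x) z) (fun z => ?_)
    fun x => (h.hasDeriv _).measurable
  rw [continuous_iff_continuousAt]
  intro x
  rw [ContinuousAt, tendsto_iff_dist_tendsto_zero]
  have hlim : Tendsto (fun y : ℕ → RdSpace d =>
      C * (1 + ‖z‖ ^ (ℓ / 2)) * ∑ j ∈ Finset.range i, ‖y j - x j‖ ^ α) (𝓝 x) (𝓝 0) := by
    have hc : Continuous fun y : ℕ → RdSpace d =>
        C * (1 + ‖z‖ ^ (ℓ / 2)) * ∑ j ∈ Finset.range i, ‖y j - x j‖ ^ α := by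
      refine continuous_const.mul (continuous_finsetSum _ fun j _ => ?_)
      exact (Real.continuous_rpow_const h.α_pos.le).comp (by fun_prop)
    simpa [Real.zero_rpow h.α_pos.ne'] using hc.tendsto x
  refine squeeze_zero (fun _ => dist_nonneg) (fun y => ?_) hlim
  have := h.abs_sub_mix_partialEmpirical_le m₀ hi x y 1 z
  rwa [PMoment.mix_one] at this

theorem measurable_deriv_comp (h : HasSmoothDerivs U D H C α) (m₀ : PMoment d ℓ)
    {n i : ℕ} (hi : i ≤ n + 1) {Ω : Type*} [MeasurableSpace Ω] {X : Ω → ℕ → RdSpace d}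
    {Z : Ω → RdSpace d} (hX : Measurable X) (hZ : Measurable Z) :
    Measurable fun ω => D (m₀.partialEmpirical n i (X ω)) (Z ω) := by
  have hp : Measurable fun ω => (X ω, Z ω) := hX.prodMk hZ
  have := Measurable.comp (h.measurable_uncurry_deriv m₀ hi) hp
  simpa only [Function.comp_def] using this

/-- The discretised sample factors through a finite discrete space, so nothing is needed of `G`. -/
theorem measurable_comp_simpleFunc {β : Type*} [MeasurableSpace β] (m₀ : PMoment d ℓ) (n i : ℕ)
    (T : SimpleFunc (RdSpace d) (RdSpace d)) (G : PMoment d ℓ → β) (hi : i ≤ n + 1) :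
    Measurable fun x : ℕ → RdSpace d => G (m₀.partialEmpirical n i fun j => T (x j)) := by
  let q : (ℕ → RdSpace d) → (Fin (n + 1) → T.range) := fun x j => ⟨T (x j), T.mem_range_self _⟩
  have hq : Measurable q := by
    refine measurable_pi_lambda _ fun j => Measurable.subtype_mk ?_
    exact T.measurable.comp (measurable_pi_apply _)
  let g : (Fin (n + 1) → T.range) → β := fun v =>
    -- The default `0` is never read, since only coordinates below `i ≤ n + 1` matter.
    G (m₀.partialEmpirical n i fun j => if hj : j < n + 1 then (v ⟨j, hj⟩ : RdSpace d) else 0)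
  have hg : Measurable g := Measurable.of_discrete
  convert hg.comp hq using 1
  funext x
  simp only [g, q, Function.comp_apply]
  congr 1
  refine m₀.partialEmpirical_congr n fun j hj => ?_
  rw [dif_pos (hj.trans_le hi)]

/-- `D` is merely measurable in space, so `U` need not be continuous in the sample, and its values
at discretised samples need not converge. Adding the first-order Taylor correction at the
discretised sample restores pointwise convergence, and every corrected approximation is measurable.
-/
theorem measurable_partialEmpirical (h : HasSmoothDerivs U D H C α) (hℓ : 0 ≤ ℓ)
    (m₀ : PMoment d ℓ) {n i : ℕ} (hi : i ≤ n + 1) :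
    Measurable fun x : ℕ → RdSpace d => U (m₀.partialEmpirical n i x) := by
  have hT : ∀ k, Measurable fun x : ℕ → RdSpace d => fun j => approxId d k (x j) := fun k =>
    measurable_pi_lambda _ fun j => (approxId d k).measurable.comp (measurable_pi_apply j)
  refine measurable_of_tendsto_metrizable (f := fun k (x : ℕ → RdSpace d) =>
    U (m₀.partialEmpirical n i fun j => approxId d k (x j)) + ((n : ℝ) + 1)⁻¹ *
      ∑ j ∈ Finset.range i, (D (m₀.partialEmpirical n i fun j => approxId d k (x j)) (x j)
        - D (m₀.partialEmpirical n i fun j => approxId d k (x j)) (approxId d k (x j))))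
    (fun k => ?_) ?_
  · refine (measurable_comp_simpleFunc m₀ n i _ U hi).add (Measurable.const_mul ?_ _)
    refine Finset.measurable_fun_sum _ fun j _ => Measurable.sub ?_ ?_
    · exact h.measurable_deriv_comp m₀ hi (hT k) (measurable_pi_apply j)
    · exact h.measurable_deriv_comp m₀ hi (hT k)
        ((approxId d k).measurable.comp (measurable_pi_apply j))
  · rw [tendsto_pi_nhds]
    intro x
    rw [tendsto_iff_dist_tendsto_zero]
    refine squeeze_zero (fun _ => dist_nonneg) (fun k => ?_) (?_ : Tendsto (fun k =>
      (∑ j ∈ Finset.range i, ‖x j - approxId d k (x j)‖ ^ α) *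
          (C * ∑ j ∈ Finset.range i, (2 + ‖x j‖ ^ (ℓ / 2) + ‖approxId d k (x j)‖ ^ (ℓ / 2))))
        atTop (𝓝 0))
    · rw [dist_comm]
      exact h.taylor_partialEmpirical m₀ hi (fun j => approxId d k (x j)) x
    · have h1 : Tendsto (fun k => ∑ j ∈ Finset.range i, ‖x j - approxId d k (x j)‖ ^ α) atTop
          (𝓝 (∑ j ∈ Finset.range i, ‖x j - x j‖ ^ α)) := by
        refine tendsto_finsetSum _ fun j _ => ?_
        exact (Real.continuousAt_rpow_const _ _ (Or.inr h.α_pos.le)).tendsto.comp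
          (tendsto_const_nhds.sub (tendsto_approxId _)).norm
      have h2 : Tendsto (fun k => C * ∑ j ∈ Finset.range i,
          (2 + ‖x j‖ ^ (ℓ / 2) + ‖approxId d k (x j)‖ ^ (ℓ / 2))) atTop
          (𝓝 (C * ∑ j ∈ Finset.range i, (2 + ‖x j‖ ^ (ℓ / 2) + ‖x j‖ ^ (ℓ / 2)))) := by
        refine (tendsto_finsetSum _ fun j _ => tendsto_const_nhds.add ?_).const_mul C
        exact (Real.continuousAt_rpow_const _ _ (Or.inr (by linarith))).tendsto.comp
          (tendsto_approxId _).norm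
      simpa [Real.zero_rpow h.α_pos.ne'] using h1.mul h2

/-- Linearity in `w` is the point: only a first moment of the gap bound is available. For `w ≤ 1`
the Hölder estimate gives a square of order `w ^ 2 ≤ w`; for `w ≥ 1` the growth of `D` together with
`IsGapBound.moment_le` suffices. -/
theorem sq_sub_le (h : HasSmoothDerivs U D H C α) {m₀ μ : PMoment d ℓ} {w : ℝ}
    (hw : IsGapBound α m₀ μ w) (x : RdSpace d) :
    (D μ x - D m₀ x) ^ 2 ≤ 6 * C ^ 2 * w * (1 + m₀.moment + ‖x‖ ^ ℓ) := by
  have hC := h.one_le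
  have hw0 := hw.nonneg
  have hM := m₀.moment_nonneg
  have hx : 0 ≤ ‖x‖ ^ ℓ := by positivity
  have hx2 : (‖x‖ ^ (ℓ / 2)) ^ 2 = ‖x‖ ^ ℓ := by
    rw [← Real.rpow_natCast, ← Real.rpow_mul (norm_nonneg _)]
    congr 1
    push_cast
    ring
  rcases le_total w 1 with hw1 | hw1
  · have hK : 0 < C * (1 + ‖x‖ ^ (ℓ / 2)) := by positivity
    obtain ⟨s, hs⟩ := IsLinearFunctionalDeriv.exists_sub_eq (fun m => h.hasDeriv₂ m x) m₀ μ
    set ρ := m₀.mix μ s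
    -- The measure `ρ` depends on `x` and `μ`, which is harmless because `w` is uniform over test
    -- functions.
    have hg := hw (fun y => H ρ x y / (C * (1 + ‖x‖ ^ (ℓ / 2))))
      ((h.hasDeriv₂ ρ x).measurable.div_const _) (by simp [(h.hasDeriv₂ ρ x).normalised]) (by
        intro y z
        rw [← sub_div, abs_div, abs_of_pos hK, div_le_iff₀ hK, mul_comm]
        refine (h.holder ρ x y z).trans (mul_le_mul_of_nonneg_left ?_ hK.le)
        exact le_add_of_nonneg_right (abs_nonneg _))
    rw [integral_div, integral_div, ← sub_div, ← hs, abs_div, abs_of_pos hK, div_le_iff₀ hK] at hg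
    calc (D μ x - D m₀ x) ^ 2 = |D μ x - D m₀ x| ^ 2 := (sq_abs _).symm
      _ ≤ (w * (C * (1 + ‖x‖ ^ (ℓ / 2)))) ^ 2 := pow_le_pow_left₀ (abs_nonneg _) hg 2
      _ = C ^ 2 * (w * w) * (1 + ‖x‖ ^ (ℓ / 2)) ^ 2 := by ring
      _ ≤ C ^ 2 * (w * 1) * (2 * (1 + ‖x‖ ^ ℓ)) := by
        gcongr
        nlinarith [sq_nonneg (1 - ‖x‖ ^ (ℓ / 2))]
      _ = 2 * (C ^ 2 * w) * (1 + ‖x‖ ^ ℓ) := by ring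
      _ ≤ 6 * (C ^ 2 * w) * (1 + m₀.moment + ‖x‖ ^ ℓ) := by
        gcongr <;> linarith
      _ = _ := by ring
  · have h1 := h.sq_le μ x
    have h2 := h.sq_le m₀ x
    have h3 := hw.moment_le
    calc (D μ x - D m₀ x) ^ 2 ≤ 2 * (D μ x ^ 2 + D m₀ x ^ 2) := by
          nlinarith [sq_nonneg (D μ x + D m₀ x)]
      _ ≤ 2 * (C * (1 + ‖x‖ ^ ℓ + μ.moment) + C * (1 + ‖x‖ ^ ℓ + m₀.moment)) := by gcongr
      _ = C * (2 * (2 + 2 * ‖x‖ ^ ℓ + m₀.moment + μ.moment)) := by ring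
      _ ≤ C * (6 * w * (1 + m₀.moment + ‖x‖ ^ ℓ)) := by
        refine mul_le_mul_of_nonneg_left ?_ (by linarith)
        nlinarith [mul_le_mul_of_nonneg_right hw1 hM, mul_le_mul_of_nonneg_right hw1 hx]
      _ ≤ C ^ 2 * (6 * w * (1 + m₀.moment + ‖x‖ ^ ℓ)) := by
        gcongr
        nlinarith
      _ = _ := by ring

theorem integral_sq_sub_le (h : HasSmoothDerivs U D H C α) {m₀ μ : PMoment d ℓ} {w : ℝ}
    (hw : IsGapBound α m₀ μ w) :
    ∫ x, (D μ x - D m₀ x) ^ 2 ∂m₀.toMeasure ≤ 6 * C ^ 2 * (1 + 2 * m₀.moment) * w := by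
  refine (integral_mono_of_nonneg (Eventually.of_forall fun x => sq_nonneg _) ?_
    (Eventually.of_forall fun x => h.sq_sub_le hw x)).trans (le_of_eq ?_)
  · exact ((integrable_const _).add m₀.integrable_rpow).const_mul _
  · rw [integral_const_mul, integral_add (integrable_const _) m₀.integrable_rpow]
    simp only [integral_const, probReal_univ, one_smul, PMoment.moment]
    ring

end HasSmoothDerivs

/-! ### Martingale differences on an infinite product space. -/

theorem comp_update_eq {E : Type*} {k : ℕ} {F : (ℕ → E) → E → ℝ}
    (hF : ∀ x y, (∀ j < k, x j = y j) → F x = F y) (p : (ℕ → E) × E) :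
    F (Function.update p.1 k p.2) (Function.update p.1 k p.2 k) = F p.1 p.2 := by
  rw [Function.update_self, hF _ p.1 fun j hj => Function.update_of_ne hj.ne _ _]

section ProductSpace

variable {E : Type*} [MeasurableSpace E] (ρ : Measure E) [IsProbabilityMeasure ρ]

/-- Resampling one coordinate independently preserves the product law. This replaces conditional
expectations below. -/
theorem measurePreserving_update_infinitePi (k : ℕ) :
    MeasurePreserving (fun p : (ℕ → E) × E => Function.update p.1 k p.2)
      ((Measure.infinitePi fun _ : ℕ => ρ).prod ρ) (Measure.infinitePi fun _ : ℕ => ρ) := by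
  have hm : Measurable fun p : (ℕ → E) × E => Function.update p.1 k p.2 := by
    refine measurable_pi_lambda _ fun j => ?_
    by_cases hj : j = k
    · subst hj; simpa using measurable_snd
    · simp only [Function.update_of_ne hj]
      exact (measurable_pi_apply j).comp measurable_fst
  refine ⟨hm, Measure.eq_infinitePi _ fun s t ht => ?_⟩
  rw [Measure.map_apply hm (MeasurableSet.pi s.countable_toSet fun j _ => ht j)]
  by_cases hk : k ∈ s
  · have : (fun p : (ℕ → E) × E => Function.update p.1 k p.2) ⁻¹' Set.pi s t
        = Set.pi (s.erase k) t ×ˢ t k := by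
      ext p
      simp only [Set.mem_preimage, Set.mem_pi, Set.mem_prod, Finset.mem_coe, Finset.mem_erase]
      refine ⟨fun h => ⟨fun j hj => ?_, ?_⟩, fun h j hj => ?_⟩
      · simpa [Function.update_of_ne hj.1] using h j hj.2
      · simpa using h k hk
      · by_cases hjk : j = k
        · subst hjk; simpa using h.2
        · simpa [Function.update_of_ne hjk] using h.1 j ⟨hjk, hj⟩
    rw [this, Measure.prod_prod, Measure.infinitePi_pi _ fun j _ => ht j, mul_comm,
      Finset.mul_prod_erase s (fun j => ρ (t j)) hk]
  · have : (fun p : (ℕ → E) × E => Function.update p.1 k p.2) ⁻¹' Set.pi s t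
        = Set.pi s t ×ˢ Set.univ := by
      ext p
      simp only [Set.mem_preimage, Set.mem_pi, Set.mem_prod, Finset.mem_coe, Set.mem_univ, and_true]
      refine forall₂_congr fun j hj => ?_
      rw [Function.update_of_ne (by rintro rfl; exact hk hj)]
    rw [this, Measure.prod_prod, Measure.infinitePi_pi _ fun j _ => ht j, measure_univ, mul_one]

variable {ρ} {k : ℕ} {F : (ℕ → E) → E → ℝ}

theorem integrable_prod_of_predictable (hF : ∀ x y, (∀ j < k, x j = y j) → F x = F y)
    (hi : Integrable (fun x => F x (x k)) (Measure.infinitePi fun _ : ℕ => ρ)) :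
    Integrable (fun p : (ℕ → E) × E => F p.1 p.2) ((Measure.infinitePi fun _ : ℕ => ρ).prod ρ) := by
  refine ((measurePreserving_update_infinitePi ρ k).integrable_comp_of_integrable hi).congr
    (Eventually.of_forall fun p => ?_)
  exact comp_update_eq hF p

/-- Resampling coordinate `k` leaves `F x` unchanged, so Fubini integrates out the fresh variable
first. -/
theorem integral_of_predictable (hF : ∀ x y, (∀ j < k, x j = y j) → F x = F y)
    (hi : Integrable (fun x => F x (x k)) (Measure.infinitePi fun _ : ℕ => ρ)) :
    ∫ x, F x (x k) ∂(Measure.infinitePi fun _ : ℕ => ρ)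
      = ∫ x, ∫ z, F x z ∂ρ ∂(Measure.infinitePi fun _ : ℕ => ρ) := by
  rw [← integral_prod _ (integrable_prod_of_predictable hF hi)]
  have h := (measurePreserving_update_infinitePi ρ k).map_eq
  rw [← h] at hi
  conv_lhs => rw [← h]
  rw [integral_map (measurePreserving_update_infinitePi ρ k).measurable.aemeasurable
    hi.aestronglyMeasurable]
  exact integral_congr_ae (Eventually.of_forall fun p => comp_update_eq hF p)

theorem integral_sq_sum_range {n : ℕ} {φ : ℕ → (ℕ → E) → E → ℝ}
    (hL : ∀ k < n, MemLp (fun x => φ k x (x k)) 2 (Measure.infinitePi fun _ : ℕ => ρ))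
    (hφ : ∀ k < n, ∀ x y, (∀ j < k, x j = y j) → φ k x = φ k y)
    (h0 : ∀ k < n, ∀ x, ∫ z, φ k x z ∂ρ = 0) :
    ∫ x, (∑ k ∈ Finset.range n, φ k x (x k)) ^ 2 ∂(Measure.infinitePi fun _ : ℕ => ρ)
      = ∑ k ∈ Finset.range n, ∫ x, φ k x (x k) ^ 2 ∂(Measure.infinitePi fun _ : ℕ => ρ) := by
  induction n with
  | zero => simp
  | succ n ih =>
    have ih' := ih (fun k hk => hL k (hk.trans n.lt_succ_self))
      (fun k hk => hφ k (hk.trans n.lt_succ_self)) fun k hk => h0 k (hk.trans n.lt_succ_self)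
    have hS : MemLp (fun x : ℕ → E => ∑ k ∈ Finset.range n, φ k x (x k)) 2
        (Measure.infinitePi fun _ : ℕ => ρ) :=
      memLp_finsetSum _ fun k hk =>
        hL k ((Finset.mem_range.1 hk).trans n.lt_succ_self)
    have hn := hL n n.lt_succ_self
    have hpred : ∀ x y : ℕ → E, (∀ j < n, x j = y j) →
        (fun z => (∑ k ∈ Finset.range n, φ k x (x k)) * φ n x z)
          = fun z => (∑ k ∈ Finset.range n, φ k y (y k)) * φ n y z := by
      intro x y hxy
      funext z
      rw [hφ n n.lt_succ_self x y hxy]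
      congr 1
      refine Finset.sum_congr rfl fun k hk => ?_
      have hk' := Finset.mem_range.1 hk
      rw [hφ k (hk'.trans n.lt_succ_self) x y fun j hj => hxy j (hj.trans hk'), hxy k hk']
    have hprod : Integrable (fun x : ℕ → E => (∑ k ∈ Finset.range n, φ k x (x k)) * φ n x (x n))
        (Measure.infinitePi fun _ : ℕ => ρ) := hS.integrable_mul hn
    -- The earlier sum is frozen while the last variable is integrated, so centring kills the cross
    -- term.
    have hcross := integral_of_predictable
      (F := fun x z => (∑ k ∈ Finset.range n, φ k x (x k)) * φ n x z) hpred hprod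
    simp only [integral_const_mul, h0 n n.lt_succ_self, mul_zero, integral_zero] at hcross
    have hexp : ∀ x : ℕ → E, (∑ k ∈ Finset.range (n + 1), φ k x (x k)) ^ 2
        = (∑ k ∈ Finset.range n, φ k x (x k)) ^ 2
          + 2 * ((∑ k ∈ Finset.range n, φ k x (x k)) * φ n x (x n)) + φ n x (x n) ^ 2 := by
      intro x
      rw [Finset.sum_range_succ]
      ring
    have hadd : Integrable (fun x : ℕ → E => (∑ k ∈ Finset.range n, φ k x (x k)) ^ 2
        + 2 * ((∑ k ∈ Finset.range n, φ k x (x k)) * φ n x (x n)))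
        (Measure.infinitePi fun _ : ℕ => ρ) := hS.integrable_sq.add (hprod.const_mul 2)
    simp only [hexp]
    rw [integral_add hadd hn.integrable_sq,
      integral_add hS.integrable_sq (hprod.const_mul 2), integral_const_mul, hcross, ih',
      Finset.sum_range_succ]
    ring

theorem integral_comp_eval {f : E → ℝ} (hf : AEStronglyMeasurable f ρ) (j : ℕ) :
    ∫ x, f (x j) ∂(Measure.infinitePi fun _ : ℕ => ρ) = ∫ z, f z ∂ρ := by
  have h := (measurePreserving_eval_infinitePi (fun _ : ℕ => ρ) j).map_eq
  conv_rhs => rw [← h]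
  rw [integral_map (measurable_pi_apply j).aemeasurable (by rwa [h])]

theorem integrable_comp_eval {f : E → ℝ} (hf : Integrable f ρ) (j : ℕ) :
    Integrable (fun x : ℕ → E => f (x j)) (Measure.infinitePi fun _ : ℕ => ρ) :=
  (measurePreserving_eval_infinitePi (fun _ : ℕ => ρ) j).integrable_comp_of_integrable hf

theorem integral_abs_le_sqrt {Ω : Type*} [MeasurableSpace Ω] {P : Measure Ω}
    [IsProbabilityMeasure P] {X : Ω → ℝ} (hX : MemLp X 2 P) :
    ∫ ω, |X ω| ∂P ≤ √(∫ ω, X ω ^ 2 ∂P) := by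
  refine Real.le_sqrt_of_sq_le ?_
  have h := variance_nonneg (fun ω => ‖X ω‖) P
  rw [variance_eq_sub hX.norm] at h
  simpa [sq_abs] using h

theorem integral_abs_sum_centered_le {f : E → ℝ} (hf : MemLp f 2 ρ) (n : ℕ) :
    ∫ x, |∑ j ∈ Finset.range n, (f (x j) - ∫ z, f z ∂ρ)| ∂(Measure.infinitePi fun _ : ℕ => ρ)
      ≤ √(n * ∫ z, (f z - ∫ z, f z ∂ρ) ^ 2 ∂ρ) := by
  have hc : MemLp (fun z => f z - ∫ z, f z ∂ρ) 2 ρ := hf.sub (memLp_const _)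
  have hL : ∀ j, MemLp (fun x : ℕ → E => f (x j) - ∫ z, f z ∂ρ) 2
      (Measure.infinitePi fun _ : ℕ => ρ) := fun j =>
    hc.comp_measurePreserving (measurePreserving_eval_infinitePi (fun _ : ℕ => ρ) j)
  refine (integral_abs_le_sqrt (memLp_finsetSum _ fun j _ => hL j)).trans (Real.sqrt_le_sqrt ?_)
  rw [integral_sq_sum_range (φ := fun _ _ z => f z - ∫ z, f z ∂ρ) (fun k _ => hL k)
    (fun _ _ _ _ _ => rfl) fun _ _ _ => by
      simp [integral_sub (hf.integrable one_le_two) (integrable_const _)],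
    Finset.sum_congr rfl fun j _ => integral_comp_eval (f := fun z => (f z - ∫ z, f z ∂ρ) ^ 2)
      hc.integrable_sq.aestronglyMeasurable j]
  simp

theorem integral_abs_sum_centered_le_sqrt {f : E → ℝ} (hf : Measurable f)
    (h01 : ∀ z, f z ∈ Set.Icc 0 1) (n : ℕ) :
    ∫ x, |∑ j ∈ Finset.range n, (f (x j) - ∫ z, f z ∂ρ)| ∂(Measure.infinitePi fun _ : ℕ => ρ)
      ≤ √n := by
  have hL : MemLp f 2 ρ := MemLp.of_bound hf.aestronglyMeasurable 1
    (Eventually.of_forall fun z => abs_le.2 ⟨by linarith [(h01 z).1], (h01 z).2⟩)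
  refine (integral_abs_sum_centered_le hL n).trans (Real.sqrt_le_sqrt ?_)
  refine mul_le_of_le_one_right n.cast_nonneg ?_
  have h1 := variance_le_expectation_sq hL.aestronglyMeasurable
  rw [variance_eq_integral hL.aemeasurable] at h1
  refine h1.trans ?_
  simpa using integral_mono hL.integrable_sq (integrable_const (1 : ℝ)) fun z =>
    pow_le_one₀ (h01 z).1 (h01 z).2

end ProductSpace

/-! ### A law of large numbers uniform over test functions. -/

section GapBound

variable {d : ℕ} {ℓ α : ℝ}

theorem testCost_approxId_le (hℓ : 0 ≤ ℓ) (k : ℕ) (y : RdSpace d) :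
    testCost ℓ α y (approxId d k y) ≤ (2 + 2 * 2 ^ ℓ) * (1 + ‖y‖ ^ ℓ) := by
  have h1 : ‖approxId d k y‖ ^ ℓ ≤ 2 ^ ℓ * ‖y‖ ^ ℓ := by
    rw [← Real.mul_rpow two_pos.le (norm_nonneg _)]
    exact Real.rpow_le_rpow (norm_nonneg _) (norm_approxId_le k y) hℓ
  have h2 : 0 ≤ ‖approxId d k y‖ ^ ℓ := by positivity
  have h3 : 0 ≤ ‖y‖ ^ ℓ := by positivity
  have h4 : (0 : ℝ) ≤ 2 ^ ℓ := by positivity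
  have h5 := min_le_right (‖y - approxId d k y‖ ^ α) (1 + ‖y‖ ^ ℓ + ‖approxId d k y‖ ^ ℓ)
  have h6 := (abs_sub (‖y‖ ^ ℓ) (‖approxId d k y‖ ^ ℓ))
  rw [abs_of_nonneg h3, abs_of_nonneg h2] at h6
  unfold testCost
  nlinarith

theorem measurable_testCost_approxId (k : ℕ) :
    Measurable fun y : RdSpace d => testCost ℓ α y (approxId d k y) := by
  have := (approxId d k).measurable
  unfold testCost
  fun_prop

theorem integrable_testCost_approxId (hℓ : 0 ≤ ℓ) (m₀ : PMoment d ℓ) (k : ℕ) :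
    Integrable (fun y => testCost ℓ α y (approxId d k y)) m₀.toMeasure :=
  m₀.integrable_of_growth (measurable_testCost_approxId k) fun y => by
    rw [abs_of_nonneg (testCost_nonneg _ _)]
    exact testCost_approxId_le hℓ k y

/-- The minimum in `testCost` provides a dominating function of growth `ℓ` for whatever `α`. -/
theorem tendsto_integral_testCost_approxId (hℓ : 0 ≤ ℓ) (hα : 0 < α) (m₀ : PMoment d ℓ) :
    Tendsto (fun k => ∫ y, testCost ℓ α y (approxId d k y) ∂m₀.toMeasure) atTop (𝓝 0) := by
  rw [show (0 : ℝ) = ∫ _, (0 : ℝ) ∂m₀.toMeasure by simp]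
  refine tendsto_integral_of_dominated_convergence (fun y => (2 + 2 * 2 ^ ℓ) * (1 + ‖y‖ ^ ℓ))
    (fun k => (measurable_testCost_approxId k).aestronglyMeasurable)
    (((integrable_const _).add m₀.integrable_rpow).const_mul _)
    (fun k => Eventually.of_forall fun y => ?_) (Eventually.of_forall fun y => ?_)
  · rw [Real.norm_eq_abs, abs_of_nonneg (testCost_nonneg _ _)]
    exact testCost_approxId_le hℓ k y
  · have hy := tendsto_approxId y
    have h1 : Tendsto (fun k => ‖y - approxId d k y‖ ^ α) atTop (𝓝 (‖y - y‖ ^ α)) :=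
      (Real.continuousAt_rpow_const _ _ (Or.inr hα.le)).tendsto.comp
        (tendsto_const_nhds.sub hy).norm
    have h2 : Tendsto (fun k => ‖approxId d k y‖ ^ ℓ) atTop (𝓝 (‖y‖ ^ ℓ)) :=
      (Real.continuousAt_rpow_const _ _ (Or.inr hℓ)).tendsto.comp hy.norm
    have h3 : 0 ≤ 1 + ‖y‖ ^ ℓ + ‖y‖ ^ ℓ := by positivity
    have := (h1.min (h2.const_add (1 + ‖y‖ ^ ℓ))).add (h2.const_sub (‖y‖ ^ ℓ)).abs
    simpa [testCost, Real.zero_rpow hα.ne', min_eq_left h3] using this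

/-- A bound in the sense of `IsGapBound` for `partialEmpirical m₀ n i x`, obtained by comparing test
functions to their compositions with `approxId d k`. -/
noncomputable def gapBound (α : ℝ) (m₀ : PMoment d ℓ) (k n i : ℕ) (x : ℕ → RdSpace d) : ℝ :=
  ((n : ℝ) + 1)⁻¹ * (∑ j ∈ Finset.range (n + 1), (testCost ℓ α (x j) (approxId d k (x j))
      + ∫ y, testCost ℓ α y (approxId d k y) ∂m₀.toMeasure)
    + ∑ p ∈ (approxId d k).range, testCost ℓ α p 0 *
      |∑ j ∈ Finset.range i, ((approxId d k ⁻¹' {p}).indicator 1 (x j)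
        - ∫ y, (approxId d k ⁻¹' {p}).indicator (1 : RdSpace d → ℝ) y ∂m₀.toMeasure)|)

/-- Split `g` into `g - g ∘ T` and `g ∘ T`. The modulus bounds the first; the second is a finite
combination of fibre indicators with coefficients `|g p| ≤ testCost ℓ α p 0`. No trace of `g`
remains. -/
theorem isGapBound_gapBound (hℓ : 0 ≤ ℓ) (m₀ : PMoment d ℓ) (k : ℕ) {n i : ℕ} (hi : i ≤ n + 1)
    (x : ℕ → RdSpace d) :
    IsGapBound α m₀ (m₀.partialEmpirical n i x) (gapBound α m₀ k n i x) := by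
  intro g hg hg0 hgc
  set T := approxId d k with hT
  have hN0 : 0 ≤ ((n : ℝ) + 1)⁻¹ := by positivity
  have hg0' : ∀ p, |g p| ≤ testCost ℓ α p 0 := fun p => by simpa [hg0] using hgc p 0
  have hgi : ∀ m : PMoment d ℓ, Integrable g m.toMeasure := fun m =>
    m.integrable_of_growth hg fun y => (hg0' y).trans (testCost_zero_le y)
  have hind : ∀ p, Integrable ((T ⁻¹' {p}).indicator (1 : RdSpace d → ℝ)) m₀.toMeasure := fun p =>
    (integrable_const (1 : ℝ)).indicator (T.measurableSet_fiber p)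
  have hgT : ∀ y, g (T y) = ∑ p ∈ T.range, g p * (T ⁻¹' {p}).indicator (1 : RdSpace d → ℝ) y := by
    intro y
    rw [Finset.sum_eq_single (T y)]
    · simp
    · intro p _ hp
      simp [hp.symm]
    · intro h; exact absurd (T.mem_range_self y) h
  have hgTi : Integrable (fun y => g (T y)) m₀.toMeasure := by
    simp only [hgT]
    exact integrable_finsetSum _ fun p _ => (hind p).const_mul _
  have hdec : ∀ j, g (x j) - ∫ y, g y ∂m₀.toMeasure
      = ((g (x j) - g (T (x j))) - ∫ y, (g y - g (T y)) ∂m₀.toMeasure)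
        + ∑ p ∈ T.range, g p * ((T ⁻¹' {p}).indicator 1 (x j)
          - ∫ y, (T ⁻¹' {p}).indicator (1 : RdSpace d → ℝ) y ∂m₀.toMeasure) := by
    intro j
    have h1 : ∫ y, g (T y) ∂m₀.toMeasure
        = ∑ p ∈ T.range, g p * ∫ y, (T ⁻¹' {p}).indicator (1 : RdSpace d → ℝ) y ∂m₀.toMeasure := by
      simp only [hgT]
      rw [integral_finsetSum _ fun p _ => (hind p).const_mul _]
      simp only [integral_const_mul]
    rw [integral_sub (hgi m₀) hgTi]
    simp only [mul_sub, Finset.sum_sub_distrib]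
    rw [← h1, ← hgT]
    ring
  have hI : |∫ y, (g y - g (T y)) ∂m₀.toMeasure| ≤ ∫ y, testCost ℓ α y (T y) ∂m₀.toMeasure :=
    (Real.norm_eq_abs _).symm.trans_le <| norm_integral_le_of_norm_le
      (integrable_testCost_approxId hℓ m₀ k) (Eventually.of_forall fun y => hgc y (T y))
  rw [PMoment.integral_partialEmpirical hgi hi, abs_mul, abs_of_nonneg hN0, gapBound]
  refine mul_le_mul_of_nonneg_left ?_ hN0
  rw [Finset.sum_congr rfl fun j _ => hdec j, Finset.sum_add_distrib, Finset.sum_comm]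
  refine (abs_add_le _ _).trans (add_le_add ?_ ?_)
  · refine (Finset.abs_sum_le_sum_abs _ _).trans ((Finset.sum_le_sum fun j _ =>
      (abs_sub _ _).trans (add_le_add (hgc _ _) hI)).trans ?_)
    refine Finset.sum_le_sum_of_subset_of_nonneg (Finset.range_mono hi) fun j _ _ => ?_
    exact add_nonneg (testCost_nonneg _ _) (integral_nonneg fun y => testCost_nonneg _ _)
  · refine (Finset.abs_sum_le_sum_abs _ _).trans (Finset.sum_le_sum fun p _ => ?_)
    rw [← Finset.mul_sum, abs_mul]
    exact mul_le_mul_of_nonneg_right (hg0' p) (abs_nonneg _)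

theorem integrable_indicator_fiber (m₀ : PMoment d ℓ) (k i : ℕ) (p : RdSpace d) :
    Integrable (fun x : ℕ → RdSpace d => |∑ j ∈ Finset.range i,
      ((approxId d k ⁻¹' {p}).indicator 1 (x j)
        - ∫ y, (approxId d k ⁻¹' {p}).indicator (1 : RdSpace d → ℝ) y ∂m₀.toMeasure)|)
      (Measure.infinitePi fun _ : ℕ => m₀.toMeasure) := by
  refine (integrable_finsetSum _ fun j _ => Integrable.sub ?_ (integrable_const _)).abs
  exact integrable_comp_eval (f := (approxId d k ⁻¹' {p}).indicator (1 : RdSpace d → ℝ))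
    ((integrable_const (1 : ℝ)).indicator ((approxId d k).measurableSet_fiber p)) j

theorem integrable_gapBound (hℓ : 0 ≤ ℓ) (m₀ : PMoment d ℓ) (k n i : ℕ) :
    Integrable (gapBound α m₀ k n i) (Measure.infinitePi fun _ : ℕ => m₀.toMeasure) := by
  unfold gapBound
  refine (Integrable.add ?_ ?_).const_mul _
  · refine integrable_finsetSum _ fun j _ => Integrable.add ?_ (integrable_const _)
    exact integrable_comp_eval (integrable_testCost_approxId hℓ m₀ k) j
  · exact integrable_finsetSum _ fun p _ => (integrable_indicator_fiber m₀ k i p).const_mul _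

/-- A discretisation bias independent of `n`, plus a fluctuation of order `1 / √(n + 1)` for fixed
`k`; both are uniform in `i`. -/
theorem integral_gapBound_le (hℓ : 0 ≤ ℓ) (m₀ : PMoment d ℓ) (k : ℕ) {n i : ℕ} (hi : i ≤ n + 1) :
    ∫ x, gapBound α m₀ k n i x ∂(Measure.infinitePi fun _ : ℕ => m₀.toMeasure)
      ≤ 2 * ∫ y, testCost ℓ α y (approxId d k y) ∂m₀.toMeasure
        + (√((n : ℝ) + 1))⁻¹ * ∑ p ∈ (approxId d k).range, testCost ℓ α p 0 := by
  unfold gapBound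
  have hn : (0 : ℝ) < n + 1 := by positivity
  have h1 := fun j => integrable_comp_eval
    (integrable_testCost_approxId (α := α) hℓ m₀ k) j
  have h1' : ∀ j, Integrable (fun x : ℕ → RdSpace d => testCost ℓ α (x j) (approxId d k (x j))
      + ∫ y, testCost ℓ α y (approxId d k y) ∂m₀.toMeasure)
      (Measure.infinitePi fun _ : ℕ => m₀.toMeasure) := fun j => (h1 j).add (integrable_const _)
  have h1'' := fun p => (integrable_indicator_fiber m₀ k i p).const_mul (testCost ℓ α p 0)
  rw [integral_const_mul, integral_add (integrable_finsetSum _ fun j _ => h1' j)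
    (integrable_finsetSum _ fun p _ => h1'' p), integral_finsetSum _ fun j _ => h1' j,
    integral_finsetSum _ fun p _ => h1'' p, mul_add]
  refine add_le_add (le_of_eq ?_) ?_
  · have h2 : ∀ j, ∫ x : ℕ → RdSpace d, (testCost ℓ α (x j) (approxId d k (x j))
        + ∫ y, testCost ℓ α y (approxId d k y) ∂m₀.toMeasure)
          ∂(Measure.infinitePi fun _ : ℕ => m₀.toMeasure)
        = 2 * ∫ y, testCost ℓ α y (approxId d k y) ∂m₀.toMeasure := by
      intro j
      rw [integral_add (h1 j) (integrable_const _), integral_comp_eval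
        (f := fun y => testCost ℓ α y (approxId d k y))
        (measurable_testCost_approxId k).aestronglyMeasurable]
      simp only [integral_const, probReal_univ, one_smul]
      ring
    simp only [h2, Finset.sum_const, Finset.card_range, nsmul_eq_mul]
    push_cast
    field_simp
  · rw [Finset.mul_sum, Finset.mul_sum]
    refine Finset.sum_le_sum fun p _ => ?_
    rw [integral_const_mul]
    have h3 := integral_abs_sum_centered_le_sqrt (ρ := m₀.toMeasure)
      (f := (approxId d k ⁻¹' {p}).indicator (1 : RdSpace d → ℝ))
      (measurable_one.indicator ((approxId d k).measurableSet_fiber p)) (fun z => by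
        by_cases hz : z ∈ approxId d k ⁻¹' {p}
        · simp [Set.indicator_of_mem hz]
        · simp [Set.indicator_of_notMem hz]) i
    have h4 : √(i : ℝ) ≤ √((n : ℝ) + 1) := Real.sqrt_le_sqrt (by exact_mod_cast hi)
    calc _ ≤ ((n : ℝ) + 1)⁻¹ * (testCost ℓ α p 0 * √((n : ℝ) + 1)) := by
          refine mul_le_mul_of_nonneg_left (mul_le_mul_of_nonneg_left (h3.trans h4)
            (testCost_nonneg _ _)) (by positivity)
      _ = (√((n : ℝ) + 1))⁻¹ * testCost ℓ α p 0 := by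
          have := Real.mul_self_sqrt hn.le
          have h5 : √((n : ℝ) + 1) ≠ 0 := (Real.sqrt_pos.2 hn).ne'
          field_simp
          rw [pow_two, this]
          ring

end GapBound

/-! ### The linearisation error is `o(N^(-1/2))` in `L¹`. -/

theorem memLp_two_of_sq_le {Ω : Type*} [MeasurableSpace Ω] {P : Measure Ω} {f g : Ω → ℝ}
    (hf : Measurable f) (hg : Integrable g P) (h : ∀ ω, f ω ^ 2 ≤ g ω) : MemLp f 2 P := by
  rw [memLp_two_iff_integrable_sq hf.aestronglyMeasurable]
  refine hg.mono' (hf.pow_const 2).aestronglyMeasurable (Eventually.of_forall fun ω => ?_)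
  rw [Real.norm_eq_abs, abs_of_nonneg (sq_nonneg _)]
  exact h ω

namespace PMoment

variable {d : ℕ} {ℓ : ℝ}

theorem integrable_envelope (m₀ : PMoment d ℓ) (n : ℕ) :
    Integrable (m₀.envelope n) (Measure.infinitePi fun _ : ℕ => m₀.toMeasure) := by
  unfold envelope
  refine (integrable_const _).add (Integrable.const_mul ?_ _)
  exact integrable_finsetSum _ fun j _ => integrable_comp_eval m₀.integrable_rpow j

theorem integral_envelope (m₀ : PMoment d ℓ) (n : ℕ) :
    ∫ x, m₀.envelope n x ∂(Measure.infinitePi fun _ : ℕ => m₀.toMeasure) = 2 * m₀.moment := by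
  unfold envelope
  have h := fun j => integrable_comp_eval m₀.integrable_rpow j
  have h' : ∀ j, ∫ x : ℕ → RdSpace d, ‖x j‖ ^ ℓ ∂(Measure.infinitePi fun _ : ℕ => m₀.toMeasure)
      = m₀.moment := fun j =>
    integral_comp_eval (f := fun y => ‖y‖ ^ ℓ) m₀.integrable_rpow.aestronglyMeasurable j
  rw [integral_add (integrable_const _) ((integrable_finsetSum _ fun j _ => h j).const_mul _),
    integral_const_mul, integral_finsetSum _ fun j _ => h j]
  simp only [h', integral_const, probReal_univ, one_smul, Finset.sum_const, Finset.card_range,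
    nsmul_eq_mul]
  push_cast
  field_simp
  ring

end PMoment

namespace HasSmoothDerivs

variable {d : ℕ} {ℓ : ℝ} {U : PMoment d ℓ → ℝ} {D : PMoment d ℓ → RdSpace d → ℝ}
  {H : PMoment d ℓ → RdSpace d → RdSpace d → ℝ} {C α : ℝ}

/-- The centred increment of the first derivative between `m₀` and `partialEmpirical m₀ n i x`. -/
noncomputable def centredIncrement (D : PMoment d ℓ → RdSpace d → ℝ) (m₀ : PMoment d ℓ) (n i : ℕ)
    (x : ℕ → RdSpace d) (z : RdSpace d) : ℝ :=
  (D (m₀.partialEmpirical n i x) z - D m₀ z)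
    - ∫ y, (D (m₀.partialEmpirical n i x) y - D m₀ y) ∂m₀.toMeasure

theorem integral_centredIncrement (h : HasSmoothDerivs U D H C α) (m₀ : PMoment d ℓ) (n i : ℕ)
    (x : ℕ → RdSpace d) : ∫ z, centredIncrement D m₀ n i x z ∂m₀.toMeasure = 0 := by
  unfold centredIncrement
  have hi : Integrable (fun z => D (m₀.partialEmpirical n i x) z - D m₀ z) m₀.toMeasure :=
    (h.integrable _ _).sub (h.integrable _ _)
  rw [integral_sub hi (integrable_const _)]
  simp

theorem centredIncrement_congr (D : PMoment d ℓ → RdSpace d → ℝ) (m₀ : PMoment d ℓ) (n i : ℕ)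
    (x y : ℕ → RdSpace d) (hxy : ∀ j < i, x j = y j) :
    centredIncrement D m₀ n i x = centredIncrement D m₀ n i y := by
  unfold centredIncrement
  rw [m₀.partialEmpirical_congr n hxy]

theorem sq_integral_sub_le (h : HasSmoothDerivs U D H C α) (m₀ μ : PMoment d ℓ) :
    (∫ y, (D μ y - D m₀ y) ∂m₀.toMeasure) ^ 2 ≤ ∫ y, (D μ y - D m₀ y) ^ 2 ∂m₀.toMeasure := by
  have hL : MemLp (fun y => D μ y - D m₀ y) 2 m₀.toMeasure :=
    (h.memLp_two μ m₀).sub (h.memLp_two m₀ m₀)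
  have := variance_nonneg (fun y => D μ y - D m₀ y) m₀.toMeasure
  rw [variance_eq_sub hL] at this
  simpa using this

theorem memLp_centredIncrement (h : HasSmoothDerivs U D H C α) (hℓ : 0 ≤ ℓ) (m₀ : PMoment d ℓ)
    {n i : ℕ} (hi : i ≤ n + 1) :
    MemLp (fun x => centredIncrement D m₀ n i x (x i)) 2
      (Measure.infinitePi fun _ : ℕ => m₀.toMeasure) := by
  have hC := h.one_le
  have hrpow := integrable_comp_eval m₀.integrable_rpow i
  refine MemLp.sub (MemLp.sub ?_ ?_) ?_
  · refine memLp_two_of_sq_le (h.measurable_deriv_comp m₀ hi measurable_id (measurable_pi_apply i))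
      ((((integrable_const (1 : ℝ)).add hrpow).add (m₀.integrable_envelope n)).const_mul C) fun x => ?_
    refine (h.sq_le _ _).trans (mul_le_mul_of_nonneg_left ?_ (by linarith))
    exact add_le_add le_rfl (PMoment.moment_partialEmpirical_le hi x)
  · refine memLp_two_of_sq_le ((h.hasDeriv m₀).measurable.comp (measurable_pi_apply i))
      ((((integrable_const (1 : ℝ)).add hrpow).add (integrable_const m₀.moment)).const_mul C) fun x => ?_
    exact h.sq_le _ _
  -- Any discretisation level would do: only integrability of the bound is used, hence level `0`.
  · refine memLp_two_of_sq_le ?_ ((integrable_gapBound (α := α) hℓ m₀ 0 n i).const_mul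
      (6 * C ^ 2 * (1 + 2 * m₀.moment))) fun x => ?_
    · have hm : Measurable fun p : (ℕ → RdSpace d) × RdSpace d =>
          D (m₀.partialEmpirical n i p.1) p.2 - D m₀ p.2 :=
        (h.measurable_uncurry_deriv m₀ hi).sub ((h.hasDeriv m₀).measurable.comp measurable_snd)
      exact hm.stronglyMeasurable.integral_prod_right.measurable
    · exact (h.sq_integral_sub_le m₀ _).trans
        (h.integral_sq_sub_le (isGapBound_gapBound hℓ m₀ 0 hi x))

/-- Integrating out `x i` first turns the inner integral into a variance, at most the second moment
of `D μ_i - D m₀`, to which the gap bound applies. -/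
theorem integral_sq_centredIncrement_le (h : HasSmoothDerivs U D H C α) (hℓ : 0 ≤ ℓ)
    (m₀ : PMoment d ℓ) (k : ℕ) {n i : ℕ} (hi : i ≤ n + 1) :
    ∫ x, centredIncrement D m₀ n i x (x i) ^ 2 ∂(Measure.infinitePi fun _ : ℕ => m₀.toMeasure)
      ≤ 6 * C ^ 2 * (1 + 2 * m₀.moment) *
        (2 * ∫ y, testCost ℓ α y (approxId d k y) ∂m₀.toMeasure
          + (√((n : ℝ) + 1))⁻¹ * ∑ p ∈ (approxId d k).range, testCost ℓ α p 0) := by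
  have hM := m₀.moment_nonneg
  rw [integral_of_predictable (F := fun x z => centredIncrement D m₀ n i x z ^ 2)
    (fun x y hxy => by rw [centredIncrement_congr D m₀ n i x y hxy])
    (h.memLp_centredIncrement hℓ m₀ hi).integrable_sq]
  refine (integral_mono_of_nonneg (Eventually.of_forall fun x =>
    integral_nonneg fun z => sq_nonneg _) ((integrable_gapBound (α := α) hℓ m₀ k n i).const_mul
      (6 * C ^ 2 * (1 + 2 * m₀.moment))) (Eventually.of_forall fun x => ?_)).trans ?_
  · refine le_trans ?_ (h.integral_sq_sub_le (isGapBound_gapBound hℓ m₀ k hi x))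
    have hL : MemLp (fun y => D (m₀.partialEmpirical n i x) y - D m₀ y) 2 m₀.toMeasure :=
      (h.memLp_two _ m₀).sub (h.memLp_two m₀ m₀)
    have h1 := variance_le_expectation_sq hL.aestronglyMeasurable
    rw [variance_eq_integral hL.aemeasurable] at h1
    exact h1
  · rw [integral_const_mul]
    exact mul_le_mul_of_nonneg_left (integral_gapBound_le hℓ m₀ k hi) (by positivity)

/-- The error in the linearisation of `U` at `m₀`, evaluated at the empirical measure. -/
noncomputable def linearizationError (U : PMoment d ℓ → ℝ) (D : PMoment d ℓ → RdSpace d → ℝ)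
    (m₀ : PMoment d ℓ) (n : ℕ) (x : ℕ → RdSpace d) : ℝ :=
  U (m₀.partialEmpirical n (n + 1) x) - U m₀
    - ((n : ℝ) + 1)⁻¹ * ∑ j ∈ Finset.range (n + 1), (D m₀ (x j) - ∫ y, D m₀ y ∂m₀.toMeasure)

theorem abs_linearizationError_le (h : HasSmoothDerivs U D H C α) (m₀ : PMoment d ℓ) (n : ℕ)
    (x : ℕ → RdSpace d) :
    |linearizationError U D m₀ n x|
      ≤ ((n : ℝ) + 1)⁻¹ * (|∑ i ∈ Finset.range (n + 1), centredIncrement D m₀ n i x (x i)|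
        + 21 * C * (1 + 2 * m₀.envelope n x)) := by
  have hC := h.one_le
  set N : ℝ := ((n : ℝ) + 1)⁻¹ with hN
  have hN0 : 0 ≤ N := by positivity
  have hN1 : N * ((n : ℝ) + 1) = 1 := inv_mul_cancel₀ (by positivity)
  set e : ℕ → ℝ := fun i => U (m₀.partialEmpirical n (i + 1) x) - U (m₀.partialEmpirical n i x)
    - N * (D (m₀.partialEmpirical n i x) (x i)
      - ∫ y, D (m₀.partialEmpirical n i x) y ∂m₀.toMeasure) with he
  -- Telescoping: `e i` is the one-step Taylor remainder, and the rest is the martingale difference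
  -- sum.
  have hdec : linearizationError U D m₀ n x
      = N * ∑ i ∈ Finset.range (n + 1), centredIncrement D m₀ n i x (x i)
        + ∑ i ∈ Finset.range (n + 1), e i := by
    have htel := Finset.sum_range_sub (fun i => U (m₀.partialEmpirical n i x)) (n + 1)
    rw [m₀.partialEmpirical_zero] at htel
    rw [linearizationError, ← htel, Finset.mul_sum, Finset.mul_sum, ← Finset.sum_sub_distrib,
      ← Finset.sum_add_distrib]
    refine Finset.sum_congr rfl fun i _ => ?_
    simp only [he, centredIncrement]
    rw [integral_sub (h.integrable _ _) (h.integrable _ _)]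
    ring
  have he_le : ∑ i ∈ Finset.range (n + 1), |e i| ≤ N * (21 * C * (1 + 2 * m₀.envelope n x)) := by
    refine (Finset.sum_le_sum fun i hi =>
      h.taylor_succ m₀ (Nat.lt_succ_iff.1 (Finset.mem_range.1 hi)) x).trans ?_
    rw [← Finset.mul_sum, ← Finset.mul_sum, Finset.sum_add_distrib, Finset.sum_add_distrib,
      Finset.sum_const, Finset.sum_const, Finset.card_range, nsmul_eq_mul, nsmul_eq_mul]
    push_cast
    have henv : N * ∑ j ∈ Finset.range (n + 1), ‖x j‖ ^ ℓ ≤ m₀.envelope n x :=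
      le_add_of_nonneg_left m₀.moment_nonneg
    calc N ^ 2 * (21 * C * (((n : ℝ) + 1) * 1 + ∑ j ∈ Finset.range (n + 1), ‖x j‖ ^ ℓ
          + ((n : ℝ) + 1) * m₀.envelope n x))
        = N * (21 * C * (N * ((n : ℝ) + 1) + N * ∑ j ∈ Finset.range (n + 1), ‖x j‖ ^ ℓ
          + N * ((n : ℝ) + 1) * m₀.envelope n x)) := by ring
      _ ≤ N * (21 * C * (1 + 2 * m₀.envelope n x)) := by
        rw [hN1]
        refine mul_le_mul_of_nonneg_left (mul_le_mul_of_nonneg_left ?_ (by linarith)) hN0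
        linarith
  rw [hdec, mul_add]
  refine (abs_add_le _ _).trans (add_le_add ?_ ?_)
  · rw [abs_mul, abs_of_nonneg hN0]
  · exact (Finset.abs_sum_le_sum_abs _ _).trans he_le

theorem measurable_linearizationError (h : HasSmoothDerivs U D H C α) (hℓ : 0 ≤ ℓ)
    (m₀ : PMoment d ℓ) (n : ℕ) : Measurable (linearizationError U D m₀ n) := by
  unfold linearizationError
  refine ((h.measurable_partialEmpirical hℓ m₀ le_rfl).sub_const _).sub (Measurable.const_mul ?_ _)
  refine Finset.measurable_fun_sum _ fun j _ => Measurable.sub_const ?_ _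
  exact (h.hasDeriv m₀).measurable.comp (measurable_pi_apply j)

theorem memLp_sum_centredIncrement (h : HasSmoothDerivs U D H C α) (hℓ : 0 ≤ ℓ)
    (m₀ : PMoment d ℓ) (n : ℕ) :
    MemLp (fun x => ∑ i ∈ Finset.range (n + 1), centredIncrement D m₀ n i x (x i)) 2
      (Measure.infinitePi fun _ : ℕ => m₀.toMeasure) :=
  memLp_finsetSum _ fun _ hi => h.memLp_centredIncrement hℓ m₀ (Finset.mem_range.1 hi).le

theorem integrable_linearizationError_bound (h : HasSmoothDerivs U D H C α) (hℓ : 0 ≤ ℓ)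
    (m₀ : PMoment d ℓ) (n : ℕ) :
    Integrable (fun x => ((n : ℝ) + 1)⁻¹ *
      (|∑ i ∈ Finset.range (n + 1), centredIncrement D m₀ n i x (x i)|
        + 21 * C * (1 + 2 * m₀.envelope n x)))
      (Measure.infinitePi fun _ : ℕ => m₀.toMeasure) :=
  (((h.memLp_sum_centredIncrement hℓ m₀ n).integrable one_le_two).abs.add
    (((integrable_const _).add ((m₀.integrable_envelope n).const_mul 2)).const_mul _)).const_mul _

theorem integrable_linearizationError (h : HasSmoothDerivs U D H C α) (hℓ : 0 ≤ ℓ)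
    (m₀ : PMoment d ℓ) (n : ℕ) :
    Integrable (linearizationError U D m₀ n) (Measure.infinitePi fun _ : ℕ => m₀.toMeasure) :=
  (h.integrable_linearizationError_bound hℓ m₀ n).mono'
    (h.measurable_linearizationError hℓ m₀ n).aestronglyMeasurable
    (Eventually.of_forall fun x => h.abs_linearizationError_le m₀ n x)

theorem sqrt_mul_integral_linearizationError_le (h : HasSmoothDerivs U D H C α) (hℓ : 0 ≤ ℓ)
    (m₀ : PMoment d ℓ) (k n : ℕ) :
    √((n : ℝ) + 1) * ∫ x, |linearizationError U D m₀ n x|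
        ∂(Measure.infinitePi fun _ : ℕ => m₀.toMeasure)
      ≤ √(6 * C ^ 2 * (1 + 2 * m₀.moment) *
        (2 * ∫ y, testCost ℓ α y (approxId d k y) ∂m₀.toMeasure
          + (√((n : ℝ) + 1))⁻¹ * ∑ p ∈ (approxId d k).range, testCost ℓ α p 0))
        + (√((n : ℝ) + 1))⁻¹ * (21 * C * (1 + 4 * m₀.moment)) := by
  set B := 6 * C ^ 2 * (1 + 2 * m₀.moment) *
    (2 * ∫ y, testCost ℓ α y (approxId d k y) ∂m₀.toMeasure
      + (√((n : ℝ) + 1))⁻¹ * ∑ p ∈ (approxId d k).range, testCost ℓ α p 0) with hB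
  have hn : (0 : ℝ) < n + 1 := by positivity
  have hsn : √((n : ℝ) + 1) ≠ 0 := (Real.sqrt_pos.2 hn).ne'
  have hmul := Real.mul_self_sqrt hn.le
  have hL := h.memLp_sum_centredIncrement hℓ m₀ n
  have hS : ∫ x, |∑ i ∈ Finset.range (n + 1), centredIncrement D m₀ n i x (x i)|
      ∂(Measure.infinitePi fun _ : ℕ => m₀.toMeasure) ≤ √((n : ℝ) + 1) * √B := by
    rw [← Real.sqrt_mul hn.le]
    refine (integral_abs_le_sqrt hL).trans (Real.sqrt_le_sqrt ?_)
    rw [integral_sq_sum_range (fun i hi => h.memLp_centredIncrement hℓ m₀ hi.le)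
      (fun i _ => centredIncrement_congr D m₀ n i)
      fun i _ x => h.integral_centredIncrement m₀ n i x]
    refine (Finset.sum_le_sum fun i hi => h.integral_sq_centredIncrement_le hℓ m₀ k
      (Finset.mem_range.1 hi).le).trans (le_of_eq ?_)
    rw [Finset.sum_const, Finset.card_range, nsmul_eq_mul]
    push_cast
    rfl
  have hE : ∫ x, 21 * C * (1 + 2 * m₀.envelope n x)
      ∂(Measure.infinitePi fun _ : ℕ => m₀.toMeasure) = 21 * C * (1 + 4 * m₀.moment) := by
    rw [integral_const_mul, integral_add (integrable_const _)
      ((m₀.integrable_envelope n).const_mul 2), integral_const_mul, m₀.integral_envelope]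
    simp only [integral_const, probReal_univ, one_smul]
    ring
  have hle := integral_mono (h.integrable_linearizationError hℓ m₀ n).abs
    (h.integrable_linearizationError_bound hℓ m₀ n) fun x => h.abs_linearizationError_le m₀ n x
  have hEi : Integrable (fun x => 21 * C * (1 + 2 * m₀.envelope n x))
      (Measure.infinitePi fun _ : ℕ => m₀.toMeasure) :=
    ((integrable_const _).add ((m₀.integrable_envelope n).const_mul 2)).const_mul _
  rw [integral_const_mul, integral_add (hL.integrable one_le_two).abs hEi, hE] at hle
  calc _ ≤ √((n : ℝ) + 1) * (((n : ℝ) + 1)⁻¹ * (√((n : ℝ) + 1) * √B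
        + 21 * C * (1 + 4 * m₀.moment))) := by
        refine mul_le_mul_of_nonneg_left (hle.trans ?_) (Real.sqrt_nonneg _)
        exact mul_le_mul_of_nonneg_left (add_le_add hS le_rfl) (by positivity)
    _ = (√((n : ℝ) + 1) * √((n : ℝ) + 1)) * ((n : ℝ) + 1)⁻¹ * √B
        + (√((n : ℝ) + 1) * ((n : ℝ) + 1)⁻¹) * (21 * C * (1 + 4 * m₀.moment)) := by ring
    _ = _ := by
        have : √((n : ℝ) + 1) * ((n : ℝ) + 1)⁻¹ = (√((n : ℝ) + 1))⁻¹ := by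
          rw [← div_eq_mul_inv, Real.sqrt_div_self', one_div]
        rw [hmul, mul_inv_cancel₀ hn.ne', one_mul, this]

theorem tendsto_sqrt_mul_integral_linearizationError (h : HasSmoothDerivs U D H C α) (hℓ : 0 ≤ ℓ)
    (m₀ : PMoment d ℓ) :
    Tendsto (fun n : ℕ => √((n : ℝ) + 1) * ∫ x, |linearizationError U D m₀ n x|
      ∂(Measure.infinitePi fun _ : ℕ => m₀.toMeasure)) atTop (𝓝 0) := by
  have hinv : Tendsto (fun n : ℕ => (√((n : ℝ) + 1))⁻¹) atTop (𝓝 0) :=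
    tendsto_inv_atTop_zero.comp (Real.tendsto_sqrt_atTop.comp
      (tendsto_atTop_add_const_right _ _ tendsto_natCast_atTop_atTop))
  have hk : Tendsto (fun k => √(6 * C ^ 2 * (1 + 2 * m₀.moment) *
      (2 * ∫ y, testCost ℓ α y (approxId d k y) ∂m₀.toMeasure))) atTop (𝓝 0) := by
    have := ((tendsto_integral_testCost_approxId hℓ h.α_pos m₀).const_mul 2).const_mul
      (6 * C ^ 2 * (1 + 2 * m₀.moment))
    simpa [Function.comp_def] using (Real.continuous_sqrt.tendsto _).comp this
  refine tendsto_order.2 ⟨fun a ha => Eventually.of_forall fun n => ha.trans_le (by positivity),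
    fun ε hε => ?_⟩
  -- The order of choices matters: `k` is fixed first to make the bias small, then `n` is sent to
  -- infinity, as the fluctuation constant depends on `k`.
  obtain ⟨k, hk⟩ := ((tendsto_order.1 hk).2 ε hε).exists
  have hlim : Tendsto (fun n : ℕ => √(6 * C ^ 2 * (1 + 2 * m₀.moment) *
        (2 * ∫ y, testCost ℓ α y (approxId d k y) ∂m₀.toMeasure
          + (√((n : ℝ) + 1))⁻¹ * ∑ p ∈ (approxId d k).range, testCost ℓ α p 0))
        + (√((n : ℝ) + 1))⁻¹ * (21 * C * (1 + 4 * m₀.moment))) atTop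
      (𝓝 (√(6 * C ^ 2 * (1 + 2 * m₀.moment) *
        (2 * ∫ y, testCost ℓ α y (approxId d k y) ∂m₀.toMeasure
          + 0 * ∑ p ∈ (approxId d k).range, testCost ℓ α p 0))
        + 0 * (21 * C * (1 + 4 * m₀.moment)))) :=
    ((Real.continuous_sqrt.tendsto _).comp
      (((hinv.mul_const _).const_add _).const_mul _)).add (hinv.mul_const _)
  rw [zero_mul, add_zero, zero_mul, add_zero] at hlim
  filter_upwards [(tendsto_order.1 hlim).2 ε hk] with n hn
  exact (h.sqrt_mul_integral_linearizationError_le hℓ m₀ k n).trans_lt hn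

end HasSmoothDerivs

/-! ### From the hypotheses on `U` to the quantitative bounds. -/

theorem AdmitsLinearFunctionalDeriv.isLinearFunctionalDeriv {d : ℕ} {ℓ : ℝ} {F : PMoment d ℓ → ℝ}
    {μ : PMoment d ℓ} (h : AdmitsLinearFunctionalDeriv F μ) :
    IsLinearFunctionalDeriv F μ (linearFunctionalDeriv F μ) := by
  obtain ⟨D, hD⟩ := h
  rwa [hD.eq]

theorem rpow_le_one_add_rpow {r p q : ℝ} (hr : 0 ≤ r) (hp : 0 ≤ p) (hpq : p ≤ q) :
    r ^ p ≤ 1 + r ^ q := by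
  rcases le_total r 1 with h | h
  · exact (Real.rpow_le_one hr h hp).trans (le_add_of_nonneg_right (Real.rpow_nonneg hr _))
  · exact (Real.rpow_le_rpow_of_exponent_le h hpq).trans (le_add_of_nonneg_left zero_le_one)

theorem norm_sub_rpow_le {d : ℕ} {p q : ℝ} (hp : 0 ≤ p) (hp1 : p ≤ 1) (hpq : p ≤ q)
    (y z : RdSpace d) : ‖y - z‖ ^ p ≤ 2 * (1 + ‖y‖ ^ q + ‖z‖ ^ q) := by
  have h1 : (‖y‖ + ‖z‖) ^ p ≤ ‖y‖ ^ p + ‖z‖ ^ p := by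
    exact_mod_cast NNReal.rpow_add_le_add_rpow ‖y‖₊ ‖z‖₊ hp hp1
  have h2 := Real.rpow_le_rpow (norm_nonneg _) (norm_sub_le y z) hp
  have h3 := rpow_le_one_add_rpow (norm_nonneg y) hp hpq
  have h4 := rpow_le_one_add_rpow (norm_nonneg z) hp hpq
  have h5 : 0 ≤ ‖y‖ ^ q := by positivity
  have h6 : 0 ≤ ‖z‖ ^ q := by positivity
  linarith

/-- The range of `α` enters only through the second term of the minimum in `holder`. If `ℓ > 0`,
then `α ≤ min ℓ 1` lets `‖y - z‖ ^ α` be absorbed by the growth of order `ℓ`; if `ℓ = 0`, the second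
derivative is bounded outright. -/
theorem exists_hasSmoothDerivs {d : ℕ} {ℓ : ℝ} (hℓ : 0 ≤ ℓ) {U : PMoment d ℓ → ℝ}
    (hU₁ : U ∈ ClassS d 1 (ℓ / 2) ℓ) (hU₂ : U ∈ ClassS d 2 ℓ ℓ)
    {α : ℝ≥0} (hα₀ : 0 < α) (hα₁ : (α : ℝ) ≤ (if ℓ = 0 then 1 else 0) + min ℓ 1)
    (hHolder : ∃ K : ℝ≥0, ∀ (μ : PMoment d ℓ) (x : RdSpace d),
      HolderWith K α
        (fun y => iteratedLinearFunctionalDeriv U 2 μ ![x, y] / (1 + ‖x‖ ^ (ℓ / 2)))) :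
    ∃ C, HasSmoothDerivs U (fun μ x => iteratedLinearFunctionalDeriv U 1 μ ![x])
      (fun μ x y => iteratedLinearFunctionalDeriv U 2 μ ![x, y]) C α := by
  obtain ⟨K, hK⟩ := hHolder
  obtain ⟨had₁, -, C₁, hC₁⟩ := hU₁ 0 one_pos
  obtain ⟨had₂, -, C₂, hC₂⟩ := hU₂ 1 one_lt_two
  have habs : ∀ (μ : PMoment d ℓ) (x y : RdSpace d),
      |iteratedLinearFunctionalDeriv U 2 μ ![x, y]|
        ≤ |C₂| * (1 + ‖x‖ ^ ℓ + ‖y‖ ^ ℓ + μ.moment) := by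
    intro μ x y
    have h := hC₂ μ ![x, y]
    set c : ℝ := if 0 < ℓ then (∫ z, ‖z‖ ^ ℓ ∂μ.toMeasure) ^ (ℓ / ℓ) else 0 with hc
    have h1 : 0 ≤ c ∧ c ≤ μ.moment := by
      rw [hc]
      split_ifs with h0
      · rw [div_self h0.ne', Real.rpow_one]
        exact ⟨μ.moment_nonneg, le_rfl⟩
      · exact ⟨le_rfl, μ.moment_nonneg⟩
    have h2 : ∑ i : Fin (1 + 1), ‖(![x, y] : Fin (1 + 1) → RdSpace d) i‖ ^ ℓ
        = ‖x‖ ^ ℓ + ‖y‖ ^ ℓ := Fin.sum_univ_two _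
    rw [h2, ← add_assoc] at h
    have h3 := h1.1
    exact h.trans ((mul_le_mul_of_nonneg_right (le_abs_self C₂) (by positivity)).trans
      (mul_le_mul_of_nonneg_left (by linarith [h1.2]) (abs_nonneg _)))
  have hsq : ∀ (μ : PMoment d ℓ) (x : RdSpace d), iteratedLinearFunctionalDeriv U 1 μ ![x] ^ 2
      ≤ 3 * C₁ ^ 2 * (1 + ‖x‖ ^ ℓ + μ.moment) := by
    intro μ x
    have h := hC₁ μ ![x]
    set b : ℝ := if 0 < ℓ then (∫ z, ‖z‖ ^ ℓ ∂μ.toMeasure) ^ (ℓ / 2 / ℓ) else 0 with hb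
    have hb2 : b ^ 2 ≤ μ.moment := by
      rw [hb]
      split_ifs with h0
      · change (μ.moment ^ (ℓ / 2 / ℓ)) ^ 2 ≤ _
        rw [← Real.rpow_natCast, ← Real.rpow_mul μ.moment_nonneg]
        have : ℓ / 2 / ℓ * ((2 : ℕ) : ℝ) = 1 := by push_cast; field_simp
        rw [this, Real.rpow_one]
      · simpa using μ.moment_nonneg
    have ha2 : (‖x‖ ^ (ℓ / 2)) ^ 2 = ‖x‖ ^ ℓ := by
      rw [← Real.rpow_natCast, ← Real.rpow_mul (norm_nonneg _)]
      congr 1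
      push_cast
      ring
    simp only [Fin.sum_univ_succ, Fin.sum_univ_zero, Matrix.cons_val_zero, add_zero] at h
    set a := ‖x‖ ^ (ℓ / 2)
    calc iteratedLinearFunctionalDeriv U 1 μ ![x] ^ 2
        = |iteratedLinearFunctionalDeriv U 1 μ ![x]| ^ 2 := (sq_abs _).symm
      _ ≤ (C₁ * (1 + a + b)) ^ 2 := pow_le_pow_left₀ (abs_nonneg _) h 2
      _ = C₁ ^ 2 * (1 + a + b) ^ 2 := by ring
      _ ≤ C₁ ^ 2 * (3 * (1 + ‖x‖ ^ ℓ + μ.moment)) := by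
        refine mul_le_mul_of_nonneg_left ?_ (sq_nonneg _)
        nlinarith [sq_nonneg (1 - a), sq_nonneg (1 - b), sq_nonneg (a - b)]
      _ = _ := by ring
  have hhol : ∀ (μ : PMoment d ℓ) (x y z : RdSpace d),
      |iteratedLinearFunctionalDeriv U 2 μ ![x, y] - iteratedLinearFunctionalDeriv U 2 μ ![x, z]|
        ≤ K * (1 + ‖x‖ ^ (ℓ / 2)) * ‖y - z‖ ^ (α : ℝ) := by
    intro μ x y z
    have hw : 0 < 1 + ‖x‖ ^ (ℓ / 2) := by positivity
    have := (hK μ x).dist_le y z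
    rw [Real.dist_eq, ← sub_div, abs_div, abs_of_pos hw, div_le_iff₀ hw, dist_eq_norm] at this
    exact this.trans (le_of_eq (by ring))
  have hmin : ∀ (μ : PMoment d ℓ) (x y z : RdSpace d),
      |iteratedLinearFunctionalDeriv U 2 μ ![x, y] - iteratedLinearFunctionalDeriv U 2 μ ![x, z]|
        ≤ (2 * K + 8 * |C₂|) * (1 + ‖x‖ ^ (ℓ / 2)) * (1 + ‖y‖ ^ ℓ + ‖z‖ ^ ℓ) := by
    intro μ x y z
    have hw : 0 ≤ ‖x‖ ^ (ℓ / 2) := by positivity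
    rcases hℓ.eq_or_lt with h0 | h0
    · have hm : μ.moment = 1 := by simp [PMoment.moment, ← h0]
      have h1 := habs μ x y
      have h2 := habs μ x z
      have hv : ∀ v : RdSpace d, ‖v‖ ^ ℓ = 1 := fun v => by rw [← h0, Real.rpow_zero]
      rw [hm, hv, hv] at h1 h2
      have h3 := abs_sub (iteratedLinearFunctionalDeriv U 2 μ ![x, y])
        (iteratedLinearFunctionalDeriv U 2 μ ![x, z])
      have hx : ‖x‖ ^ (ℓ / 2) = 1 := by rw [← h0, zero_div, Real.rpow_zero]
      rw [hv, hv, hx]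
      linarith [K.coe_nonneg, abs_nonneg C₂]
    · rw [if_neg h0.ne', zero_add] at hα₁
      have h1 := norm_sub_rpow_le α.2 (hα₁.trans (min_le_right _ _)) (hα₁.trans (min_le_left _ _)) y z
      calc _ ≤ K * (1 + ‖x‖ ^ (ℓ / 2)) * ‖y - z‖ ^ (α : ℝ) := hhol μ x y z
        _ ≤ K * (1 + ‖x‖ ^ (ℓ / 2)) * (2 * (1 + ‖y‖ ^ ℓ + ‖z‖ ^ ℓ)) :=
          mul_le_mul_of_nonneg_left h1 (by positivity)
        _ = 2 * K * (1 + ‖x‖ ^ (ℓ / 2)) * (1 + ‖y‖ ^ ℓ + ‖z‖ ^ ℓ) := by ring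
        _ ≤ _ := by
          gcongr
          exact le_add_of_nonneg_right (by positivity)
  have hK0 := K.coe_nonneg
  -- The sum dominates the constants of `hsq`, `habs`, `hhol` and `hmin`, and the summand `1`
  -- secures `1 ≤ C`.
  refine ⟨1 + 3 * C₁ ^ 2 + 8 * |C₂| + 2 * K, ?_, ?_, ?_, hα₀, ?_, ?_, ?_⟩
  · exact fun μ => (had₁ μ Fin.elim0).isLinearFunctionalDeriv
  · intro μ x
    have h := (had₂ μ ![x]).isLinearFunctionalDeriv
    convert h using 1
    funext y
    rw [iteratedLinearFunctionalDeriv]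
    have : Fin.init ![x, y] = ![x] := by
      funext i
      fin_cases i
      rfl
    rw [this]
    rfl
  · have := sq_nonneg C₁
    have := abs_nonneg C₂
    linarith
  · intro μ x
    refine (hsq μ x).trans (mul_le_mul_of_nonneg_right ?_ ?_)
    · linarith [abs_nonneg C₂]
    · have := μ.moment_nonneg
      positivity
  · intro μ x y
    refine (habs μ x y).trans (mul_le_mul_of_nonneg_right ?_ ?_)
    · linarith [abs_nonneg C₂, sq_nonneg C₁]
    · have := μ.moment_nonneg
      positivity
  · intro μ x y z
    rw [mul_min_of_nonneg _ _ (by positivity)]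
    refine le_min ((hhol μ x y z).trans ?_) ((hmin μ x y z).trans ?_)
    · refine mul_le_mul_of_nonneg_right (mul_le_mul_of_nonneg_right ?_ ?_) ?_ <;> try positivity
      linarith [abs_nonneg C₂, sq_nonneg C₁]
    · refine mul_le_mul_of_nonneg_right (mul_le_mul_of_nonneg_right ?_ ?_) ?_ <;> try positivity
      linarith [sq_nonneg C₁]

/-! ### Transfer to the given probability space and conclusion. -/

theorem map_eq_infinitePi_of_iIndepFun_of_hasLaw {E Ω : Type*} [MeasurableSpace E]
    [MeasurableSpace Ω] {P : Measure Ω} {ρ : Measure E} {ζ : ℕ → Ω → E}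
    (hindep : iIndepFun ζ P) (hlaw : ∀ i, HasLaw (ζ i) ρ P) :
    P.map (fun ω i => ζ i ω) = Measure.infinitePi fun _ : ℕ => ρ := by
  rw [hindep.map_fun_eq_infinitePi_map₀' fun i => (hlaw i).aemeasurable]
  simp only [(hlaw _).map_eq]

namespace HasSmoothDerivs

variable {d : ℕ} {ℓ : ℝ} {U : PMoment d ℓ → ℝ} {D : PMoment d ℓ → RdSpace d → ℝ}
  {H : PMoment d ℓ → RdSpace d → RdSpace d → ℝ} {C α : ℝ}

theorem sub_eq_linearizationError_add (U : PMoment d ℓ → ℝ) (D : PMoment d ℓ → RdSpace d → ℝ)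
    (m₀ : PMoment d ℓ) (n : ℕ) (x : ℕ → RdSpace d) :
    U (PMoment.empirical fun i : Fin (n + 1) => x i) - U m₀ = linearizationError U D m₀ n x
      + ((n : ℝ) + 1)⁻¹ * ∑ j ∈ Finset.range (n + 1), (D m₀ (x j) - ∫ y, D m₀ y ∂m₀.toMeasure) := by
  rw [linearizationError, PMoment.partialEmpirical_last]
  ring

theorem integrable_sum_centered (h : HasSmoothDerivs U D H C α) (m₀ : PMoment d ℓ) (n : ℕ) :
    Integrable (fun x : ℕ → RdSpace d => ((n : ℝ) + 1)⁻¹ *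
      ∑ j ∈ Finset.range (n + 1), (D m₀ (x j) - ∫ y, D m₀ y ∂m₀.toMeasure))
      (Measure.infinitePi fun _ : ℕ => m₀.toMeasure) :=
  (integrable_finsetSum _ fun j _ =>
    (integrable_comp_eval (h.integrable m₀ m₀) j).sub (integrable_const _)).const_mul _

theorem integrable_sub (h : HasSmoothDerivs U D H C α) (hℓ : 0 ≤ ℓ) (m₀ : PMoment d ℓ) (n : ℕ) :
    Integrable (fun x : ℕ → RdSpace d => U (PMoment.empirical fun i : Fin (n + 1) => x i) - U m₀)
      (Measure.infinitePi fun _ : ℕ => m₀.toMeasure) := by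
  simp only [sub_eq_linearizationError_add U D]
  exact (h.integrable_linearizationError hℓ m₀ n).add (h.integrable_sum_centered m₀ n)

theorem sqrt_mul_integral_abs_sub_le (h : HasSmoothDerivs U D H C α) (hℓ : 0 ≤ ℓ)
    (m₀ : PMoment d ℓ) (n : ℕ) :
    √((n : ℝ) + 1) * ∫ x, |U (PMoment.empirical fun i : Fin (n + 1) => x i) - U m₀|
        ∂(Measure.infinitePi fun _ : ℕ => m₀.toMeasure)
      ≤ √((n : ℝ) + 1) * ∫ x, |linearizationError U D m₀ n x|
          ∂(Measure.infinitePi fun _ : ℕ => m₀.toMeasure)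
        + √(∫ z, (D m₀ z - ∫ y, D m₀ y ∂m₀.toMeasure) ^ 2 ∂m₀.toMeasure) := by
  have hn : (0 : ℝ) < n + 1 := by positivity
  have hE := h.integrable_linearizationError hℓ m₀ n
  have hS := h.integrable_sum_centered m₀ n
  have h1 := integral_mono (h.integrable_sub hℓ m₀ n).abs (hE.abs.add hS.abs) fun x => by
    simp only [sub_eq_linearizationError_add U D, Pi.add_apply]
    exact abs_add_le _ _
  rw [integral_add' hE.abs hS.abs] at h1
  have h2 := integral_abs_sum_centered_le (h.memLp_two m₀ m₀) (n + 1)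
  set V := ∫ z, (D m₀ z - ∫ y, D m₀ y ∂m₀.toMeasure) ^ 2 ∂m₀.toMeasure
  push_cast at h2
  rw [Real.sqrt_mul hn.le] at h2
  simp only [abs_mul, abs_of_pos (inv_pos.2 hn), integral_const_mul] at h1
  refine (mul_le_mul_of_nonneg_left h1 (Real.sqrt_nonneg _)).trans ?_
  rw [mul_add]
  refine add_le_add le_rfl ((mul_le_mul_of_nonneg_left (mul_le_mul_of_nonneg_left h2
    (inv_pos.2 hn).le) (Real.sqrt_nonneg _)).trans (le_of_eq ?_))
  rw [show √((n : ℝ) + 1) * (((n : ℝ) + 1)⁻¹ * (√((n : ℝ) + 1) * √V))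
    = (√((n : ℝ) + 1) * √((n : ℝ) + 1)) * ((n : ℝ) + 1)⁻¹ * √V by ring,
    Real.mul_self_sqrt hn.le, mul_inv_cancel₀ hn.ne', one_mul]

theorem bddAbove_sqrt_mul_integral_abs_sub (h : HasSmoothDerivs U D H C α) (hℓ : 0 ≤ ℓ)
    (m₀ : PMoment d ℓ) :
    BddAbove (Set.range fun n : ℕ => √((n : ℝ) + 1) *
      ∫ x, |U (PMoment.empirical fun i : Fin (n + 1) => x i) - U m₀|
        ∂(Measure.infinitePi fun _ : ℕ => m₀.toMeasure)) := by
  obtain ⟨B, hB⟩ := (h.tendsto_sqrt_mul_integral_linearizationError hℓ m₀).bddAbove_range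
  refine ⟨B + √(∫ z, (D m₀ z - ∫ y, D m₀ y ∂m₀.toMeasure) ^ 2 ∂m₀.toMeasure), ?_⟩
  rintro _ ⟨n, rfl⟩
  exact (h.sqrt_mul_integral_abs_sub_le hℓ m₀ n).trans
    (add_le_add (hB (Set.mem_range_self n)) le_rfl)

variable {Ω : Type*} [MeasurableSpace Ω] {P : Measure Ω}
  {ζ : ℕ → Ω → RdSpace d} {m₀ : PMoment d ℓ}

theorem tendstoInMeasure_linearizationError (h : HasSmoothDerivs U D H C α) (hℓ : 0 ≤ ℓ)
    (hindep : iIndepFun ζ P) (hlaw : ∀ i, HasLaw (ζ i) m₀.toMeasure P) :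
    TendstoInMeasure P
      (fun (n : ℕ) ω => √((n : ℝ) + 1) * linearizationError U D m₀ n fun i => ζ i ω) atTop 0 := by
  have hmap := map_eq_infinitePi_of_iIndepFun_of_hasLaw hindep hlaw
  have hζ : AEMeasurable (fun ω i => ζ i ω) P := aemeasurable_pi_iff.2 fun i =>
    (hlaw i).aemeasurable
  have hi : ∀ n : ℕ, Integrable (fun x => √((n : ℝ) + 1) * linearizationError U D m₀ n x)
      (P.map fun ω i => ζ i ω) := fun n => by
    rw [hmap]
    exact (h.integrable_linearizationError hℓ m₀ n).const_mul _
  have hi' : ∀ n : ℕ, Integrable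
      (fun ω => √((n : ℝ) + 1) * linearizationError U D m₀ n fun i => ζ i ω) P := fun n =>
    (hi n).comp_aemeasurable hζ
  refine tendstoInMeasure_of_tendsto_eLpNorm one_ne_zero
    (fun n => (hi' n).aestronglyMeasurable) aestronglyMeasurable_zero ?_
  have hlim := ENNReal.tendsto_ofReal (h.tendsto_sqrt_mul_integral_linearizationError hℓ m₀)
  rw [ENNReal.ofReal_zero] at hlim
  refine hlim.congr fun n => ?_
  rw [sub_zero, eLpNorm_one_eq_lintegral_enorm, ← ofReal_integral_norm_eq_lintegral_enorm (hi' n),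
    ← integral_const_mul, ← hmap]
  congr 1
  rw [integral_map hζ (((h.measurable_linearizationError hℓ m₀ n).abs.const_mul
    _).aestronglyMeasurable)]
  refine integral_congr_ae (Eventually.of_forall fun ω => ?_)
  simp only [Real.norm_eq_abs, abs_mul, abs_of_nonneg (Real.sqrt_nonneg _)]

theorem tendstoInDistribution_sum_centered [IsProbabilityMeasure P] (h : HasSmoothDerivs U D H C α)
    (hindep : iIndepFun ζ P) (hlaw : ∀ i, HasLaw (ζ i) m₀.toMeasure P) :
    TendstoInDistribution (fun (n : ℕ) ω => √((n : ℝ) + 1) * (((n : ℝ) + 1)⁻¹ *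
        ∑ j ∈ Finset.range (n + 1), (D m₀ (ζ j ω) - ∫ y, D m₀ y ∂m₀.toMeasure)))
      atTop (id : ℝ → ℝ) (fun _ => P) (gaussianReal 0 Var[fun ω => D m₀ (ζ 0 ω); P].toNNReal) := by
  have hm := (h.hasDeriv m₀).measurable
  have hL : MemLp (fun ω => D m₀ (ζ 0 ω)) 2 P := by
    have := h.memLp_two m₀ m₀
    rw [← (hlaw 0).map_eq] at this
    exact this.comp_of_map (hlaw 0).aemeasurable
  have hmean : ∫ ω, D m₀ (ζ 0 ω) ∂P = ∫ y, D m₀ y ∂m₀.toMeasure := by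
    rw [← (hlaw 0).map_eq, integral_map (hlaw 0).aemeasurable hm.aestronglyMeasurable]
  have hclt := tendstoInDistribution_inv_sqrt_mul_sum_sub (X := fun j ω => D m₀ (ζ j ω))
    (P := P) (Y := (id : ℝ → ℝ)) HasLaw.id hL (hindep.comp (fun _ => D m₀) fun _ => hm)
    fun i => ((hlaw i).identDistrib (hlaw 0)).comp hm
  -- The classical theorem is indexed by the number of summands, here `n + 1`.
  have hshift := TendstoInDistribution.mk (fun n => hclt.forall_aemeasurable (n + 1))
    hclt.aemeasurable_limit (hclt.tendsto.comp (tendsto_add_atTop_nat 1))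
  convert hshift using 3 with n ω
  have hn : (0 : ℝ) < n + 1 := by positivity
  have hs : √((n : ℝ) + 1) * ((n : ℝ) + 1)⁻¹ = (√((n : ℝ) + 1))⁻¹ := by
    rw [← div_eq_mul_inv, Real.sqrt_div_self', one_div]
  rw [← mul_assoc, hs, Finset.sum_sub_distrib, hmean]
  simp

theorem centralLimit [IsProbabilityMeasure P] (h : HasSmoothDerivs U D H C α) (hℓ : 0 ≤ ℓ)
    (hindep : iIndepFun ζ P) (hlaw : ∀ i, HasLaw (ζ i) m₀.toMeasure P) :
    TendstoInDistribution
      (fun (n : ℕ) ω =>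
        √((n : ℝ) + 1) * (U (PMoment.empirical fun i : Fin (n + 1) => ζ i ω) - U m₀))
      atTop (id : ℝ → ℝ) (fun _ => P) (gaussianReal 0 Var[fun ω => D m₀ (ζ 0 ω); P].toNNReal) := by
  have hsum := h.tendstoInDistribution_sum_centered hindep hlaw
  have hζ : AEMeasurable (fun ω i => ζ i ω) P := aemeasurable_pi_iff.2 fun i =>
    (hlaw i).aemeasurable
  have hdec : ∀ (n : ℕ) ω,
      √((n : ℝ) + 1) * (U (PMoment.empirical fun i : Fin (n + 1) => ζ i ω) - U m₀)
        = √((n : ℝ) + 1) * (linearizationError U D m₀ n fun i => ζ i ω) + √((n : ℝ) + 1) *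
          (((n : ℝ) + 1)⁻¹ * ∑ j ∈ Finset.range (n + 1),
            (D m₀ (ζ j ω) - ∫ y, D m₀ y ∂m₀.toMeasure)) := fun n ω => by
    rw [← mul_add, ← sub_eq_linearizationError_add U D m₀ n fun i => ζ i ω]
  -- Slutsky: the difference from the centred sum is the rescaled linearisation error, which
  -- vanishes in measure.
  refine tendstoInDistribution_of_tendstoInMeasure_sub _ _ hsum ?_ fun n => ?_
  · convert h.tendstoInMeasure_linearizationError hℓ hindep hlaw using 1
    funext n ω
    rw [Pi.sub_apply, Pi.sub_apply, hdec, add_sub_cancel_right]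
  · simp only [hdec]
    exact (((h.measurable_linearizationError hℓ m₀ n).comp_aemeasurable hζ).const_mul _).add
      (hsum.forall_aemeasurable n)

end HasSmoothDerivs

theorem mainTheorem3 {d : ℕ} {ℓ : ℝ} (hℓ : 0 ≤ ℓ) (m₀ : PMoment d ℓ)
    {Ω : Type*} [MeasurableSpace Ω] (P : Measure Ω) [IsProbabilityMeasure P]
    (ζ : ℕ → Ω → RdSpace d) (hindep : iIndepFun ζ P) (hlaw : ∀ i, HasLaw (ζ i) m₀.toMeasure P)
    (U : PMoment d ℓ → ℝ) (hU₁ : U ∈ ClassS d 1 (ℓ / 2) ℓ) (hU₂ : U ∈ ClassS d 2 ℓ ℓ)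
    (α : ℝ≥0) (hα₀ : 0 < α) (hα₁ : (α : ℝ) ≤ (if ℓ = 0 then 1 else 0) + min ℓ 1)
    (hHolder : ∃ K : ℝ≥0, ∀ (μ : PMoment d ℓ) (x : RdSpace d),
      HolderWith K α
        (fun y => iteratedLinearFunctionalDeriv U 2 μ ![x, y] / (1 + ‖x‖ ^ (ℓ / 2)))) :
    MemLp (fun ω => iteratedLinearFunctionalDeriv U 1 m₀ ![ζ 0 ω]) 2 P ∧
    TendstoInDistribution
      (fun (N : ℕ) ω =>
        √((N : ℝ) + 1) * (U (PMoment.empirical fun i : Fin (N + 1) => ζ i ω) - U m₀))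
      atTop (id : ℝ → ℝ) (fun _ => P)
      (gaussianReal 0 Var[fun ω => iteratedLinearFunctionalDeriv U 1 m₀ ![ζ 0 ω]; P].toNNReal) ∧
    (∀ N : ℕ, Integrable
      (fun ω => U (PMoment.empirical fun i : Fin (N + 1) => ζ i ω) - U m₀) P) ∧
    BddAbove (Set.range fun N : ℕ =>
      √((N : ℝ) + 1) * ∫ ω, |U (PMoment.empirical fun i : Fin (N + 1) => ζ i ω) - U m₀| ∂P) := by
  obtain ⟨C, h⟩ := exists_hasSmoothDerivs hℓ hU₁ hU₂ hα₀ hα₁ hHolder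
  have hmap := map_eq_infinitePi_of_iIndepFun_of_hasLaw hindep hlaw
  have hζ : AEMeasurable (fun ω i => ζ i ω) P := aemeasurable_pi_iff.2 fun i =>
    (hlaw i).aemeasurable
  have hint : ∀ N : ℕ, Integrable
      (fun x : ℕ → RdSpace d => U (PMoment.empirical fun i : Fin (N + 1) => x i) - U m₀)
      (P.map fun ω i => ζ i ω) := fun N => by
    rw [hmap]
    exact h.integrable_sub hℓ m₀ N
  refine ⟨?_, h.centralLimit hℓ hindep hlaw, fun N => (hint N).comp_aemeasurable hζ, ?_⟩
  · have hL := h.memLp_two m₀ m₀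
    rw [← (hlaw 0).map_eq] at hL
    exact hL.comp_of_map (hlaw 0).aemeasurable
  · convert h.bddAbove_sqrt_mul_integral_abs_sub hℓ m₀ using 4 with N
    rw [← hmap, integral_map hζ (hint N).abs.aestronglyMeasurable]
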